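/- Let $k$ be an algebraically closed field, $R$ a commutative affine (i.e. finitely generated) $k$-algebra graded by an abelian group $G$ (written additively), and $c: G\times G\to k^\times$ an alternating bicharacter. Let $A=R'$ be the twist of $R$ by $c$: a copy of the graded vector space $R$, via a linear isomorphism $r\mapsto r'$, with multiplication $r's'=c(x,y)(rs)'$ for $r\in R_x$, $s\in R_y$. Assume that either $-1$ is not in the subgroup $\langle \operatorname{im} c\rangle$ of $k^\times$, or $\operatorname{char} k=2$. Let $\operatorname{spec}$, $\max$ and $\operatorname{prim}$ denote the sets of prime, maximal and (left) primitive ideals with their Zariski topologies, and let $H=\operatorname{Hom}(G,k^\times)$ act on $R$ and $A$ by $h.r=h(x)r$ and $h.r'=h(x)r'$ for $r\in R_x$. Then there exist $H$-equivariant topological quotient maps (surjections such that a subset of the target is closed if and only if its preimage is closed) $$\phi_s:\operatorname{spec}R\twoheadrightarrow\operatorname{spec}A,\qquad \phi_m:\max R\twoheadrightarrow\operatorname{prim}A$$ with the following properties. (1) For every $P\in\operatorname{spec}R$, $\phi_s(P)$ is the largest ideal of $A$ contained in the set $P'=\{p'\mid p\in P\}$. (2) Let $r_1,\dots,r_n$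 be any homogeneous $k$-algebra generators of $R$, of degrees $\delta_1,\dots,\delta_n$. For $w\subseteq\{1,\dots,n\}$ put $\operatorname{spec}_wR=\{P\in\operatorname{spec}R\mid r_i\in P\Leftrightarrow i\in w\}$, $\operatorname{max}_wR=\max R\cap\operatorname{spec}_wR$, $\operatorname{prim}_wA=\{Q\in\operatorname{prim}A\mid r_i'\in Q\Leftrightarrow i\in w\}$, $G_w=\sum_{i\notin w}\mathbb Z\delta_i$, $\operatorname{rad}(c_w)=\{x\in G_w\mid c(x,y)=1\text{ for all }y\in G_w\}$ and $\operatorname{rad}(c_w)^\perp=\{h\in H\mid h(x)=1\text{ for all }x\in\operatorname{rad}(c_w)\}$. Write $(P:T)=\bigcap_{t\in T}t(P)$. Then $$\phi_s(P)=(P:\operatorname{rad}(c_w)^\perp)'\ \text{ for } P\in\operatorname{spec}_wR,\qquad \phi_m(M)=(M:\operatorname{rad}(c_w)^\perp)'\ \text{ for } M\in\operatorname{max}_wR,$$ and the fibres of $\phi_m$ over the points of $\operatorname{prim}_wA$ are precisely the $\operatorname{rad}(c_w)^\perp$-orbits in $\operatorname{max}_wR$. -/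

import Mathlib

universe u v w

/-! ## Prime and primitive spectra of noncommutative rings -/

/-- A two-sided ideal `P` of a (not necessarily commutative) ring is prime if it is proper and,
whenever it contains the product `IJ` of two two-sided ideals, it contains `I` or `J`. -/
structure TwoSidedIdeal.IsPrimeIdeal {A : Type u} [Ring A] (P : TwoSidedIdeal A) : Prop where
  ne_top : P ≠ ⊤
  le_or_le : ∀ I J : TwoSidedIdeal A, (∀ a ∈ I, ∀ b ∈ J, a * b ∈ P) → I ≤ P ∨ J ≤ P

/-- A two-sided ideal `P` is (left) primitive if it is the annihilator of a simple left module.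
(A simple `A`-module is a quotient of `A`, so it suffices to use modules in the universe of `A`.) -/
def TwoSidedIdeal.IsPrimitiveIdeal {A : Type u} [Ring A] (P : TwoSidedIdeal A) : Prop :=
  ∃ (M : Type u) (_ : AddCommGroup M) (_ : Module A M),
    IsSimpleModule A M ∧ ∀ a : A, a ∈ P ↔ ∀ m : M, a • m = 0

/-- Primitive ideals are prime. -/
theorem TwoSidedIdeal.IsPrimitiveIdeal.isPrimeIdeal {A : Type u} [Ring A] {P : TwoSidedIdeal A}
    (hP : P.IsPrimitiveIdeal) : P.IsPrimeIdeal := by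
  obtain ⟨M, _, _, hM, hann⟩ := hP
  have := IsSimpleModule.nontrivial A M
  refine ⟨?_, ?_⟩
  · rintro rfl
    obtain ⟨m, hm⟩ := exists_ne (0 : M)
    exact hm (by simpa using (hann 1).1 (TwoSidedIdeal.mem_top A) m)
  · intro I J h
    by_contra hc
    obtain ⟨h1, h2⟩ := not_or.1 hc
    obtain ⟨a, haI, haP⟩ := SetLike.not_le_iff_exists.1 h1
    obtain ⟨b, hbJ, hbP⟩ := SetLike.not_le_iff_exists.1 h2
    rw [hann] at haP hbP
    push Not at haP hbP
    obtain ⟨m, hm⟩ := haP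
    obtain ⟨n, hn⟩ := hbP
    have htop := IsSimpleModule.span_singleton_eq_top A hn
    have hmem : m ∈ Submodule.span A {b • n} := htop ▸ Submodule.mem_top
    obtain ⟨r, hr⟩ := Submodule.mem_span_singleton.1 hmem
    apply hm
    rw [← hr, smul_smul, smul_smul]
    exact (hann _).1 (by simpa [mul_assoc] using h _ (I.mul_mem_right _ r haI) _ hbJ) n

/-- `spec A`: the set of prime (two-sided) ideals of a ring `A`. -/
@[ext]
structure PrimeIdealSpace (A : Type u) [Ring A] where
  asIdeal : TwoSidedIdeal A
  isPrime : asIdeal.IsPrimeIdeal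

/-- `prim A`: the set of (left) primitive ideals of a ring `A`. -/
@[ext]
structure PrimitiveIdealSpace (A : Type u) [Ring A] where
  asIdeal : TwoSidedIdeal A
  isPrimitive : asIdeal.IsPrimitiveIdeal

namespace PrimeIdealSpace

variable {A : Type u} [Ring A]

/-- `V(S)`: the set of prime ideals containing the set `S`. -/
def zeroLocus (S : Set A) : Set (PrimeIdealSpace A) := {P | S ⊆ (P.asIdeal : Set A)}

/-- The Zariski topology on `spec A`: the closed sets are the sets `V(S)`. -/
instance zariskiTopology : TopologicalSpace (PrimeIdealSpace A) :=
  TopologicalSpace.ofClosed {Z | ∃ S : Set A, Z = zeroLocus S}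
    ⟨Set.univ, by
      ext P
      simp only [Set.mem_empty_iff_false, false_iff]
      intro h
      exact P.isPrime.ne_top (SetLike.coe_injective (Set.eq_univ_of_univ_subset h))⟩
    (by
      intro Z hZ
      refine ⟨⋃₀ {S | zeroLocus S ∈ Z}, ?_⟩
      ext P
      simp only [Set.mem_sInter, zeroLocus, Set.mem_ofPred_eq, Set.sUnion_subset_iff]
      constructor
      · intro h S hS
        exact h _ hS
      · intro h T hT
        obtain ⟨S, rfl⟩ := hZ hT
        exact h S hT)
    (by
      rintro _ ⟨S, rfl⟩ _ ⟨T, rfl⟩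
      refine ⟨{x | ∃ a ∈ TwoSidedIdeal.span S, ∃ b ∈ TwoSidedIdeal.span T, x = a * b}, ?_⟩
      ext P
      simp only [Set.mem_union, zeroLocus, Set.mem_ofPred_eq]
      constructor
      · rintro (h | h) _ ⟨a, ha, b, hb, rfl⟩
        · exact P.asIdeal.mul_mem_right _ _ (TwoSidedIdeal.span_le.2 h ha)
        · exact P.asIdeal.mul_mem_left _ _ (TwoSidedIdeal.span_le.2 h hb)
      · intro h
        rcases P.isPrime.le_or_le (TwoSidedIdeal.span S) (TwoSidedIdeal.span T)
          (fun a ha b hb => h ⟨a, ha, b, hb, rfl⟩) with h | h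
        · exact Or.inl (TwoSidedIdeal.span_le.1 h)
        · exact Or.inr (TwoSidedIdeal.span_le.1 h))

/-- The ideal `f(P)`, for an automorphism `f` of `A` and a prime ideal `P`. -/
def act (f : A ≃+* A) (P : PrimeIdealSpace A) : PrimeIdealSpace A where
  asIdeal := f.mapTwoSidedIdeal P.asIdeal
  isPrime := by
    have hmem : ∀ (I : TwoSidedIdeal A) (x : A),
        x ∈ f.mapTwoSidedIdeal I ↔ f.symm x ∈ I := by
      intro I x
      rw [RingEquiv.mapTwoSidedIdeal_apply, TwoSidedIdeal.mem_comap]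
    refine ⟨?_, ?_⟩
    · intro h
      apply P.isPrime.ne_top
      rw [← TwoSidedIdeal.one_mem_iff, ← map_one f.symm, ← hmem, h]
      exact TwoSidedIdeal.mem_top A
    · intro I J h
      have key : ∀ K : TwoSidedIdeal A, f.symm.mapTwoSidedIdeal K ≤ P.asIdeal →
          K ≤ f.mapTwoSidedIdeal P.asIdeal := by
        intro K hK x hx
        rw [hmem]
        apply hK
        rw [RingEquiv.mapTwoSidedIdeal_apply, TwoSidedIdeal.mem_comap]
        simpa using hx
      refine (P.isPrime.le_or_le (f.symm.mapTwoSidedIdeal I) (f.symm.mapTwoSidedIdeal J)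
        ?_).imp (key I) (key J)
      intro a ha b hb
      rw [RingEquiv.mapTwoSidedIdeal_apply, TwoSidedIdeal.mem_comap] at ha hb
      simpa [hmem] using h _ ha _ hb

end PrimeIdealSpace

namespace PrimitiveIdealSpace

variable {A : Type u} [Ring A]

/-- The inclusion of `prim A` in `spec A`. -/
def toPrime (P : PrimitiveIdealSpace A) : PrimeIdealSpace A := ⟨P.asIdeal, P.isPrimitive.isPrimeIdeal⟩

/-- The Zariski topology on `prim A`: the relative topology from `spec A`. -/
instance zariskiTopology : TopologicalSpace (PrimitiveIdealSpace A) :=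
  TopologicalSpace.induced toPrime PrimeIdealSpace.zariskiTopology

/-- The ideal `f(P)`, for an automorphism `f` of `A` and a primitive ideal `P`. -/
def act (f : A ≃+* A) (P : PrimitiveIdealSpace A) : PrimitiveIdealSpace A where
  asIdeal := f.mapTwoSidedIdeal P.asIdeal
  isPrimitive := by
    obtain ⟨M, i1, i2, hM, hann⟩ := P.isPrimitive
    have hs : IsSimpleModule A M := hM
    let i3 : Module A M := Module.compHom M (f.symm : A →+* A)
    refine ⟨M, i1, i3, ?_, ?_⟩
    · have : RingHomSurjective (f.symm : A →+* A) := ⟨f.symm.surjective⟩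
      let l : @LinearMap A A _ _ (f.symm : A →+* A) M M _ _ i3 i2 :=
        @LinearMap.mk A A _ _ (f.symm : A →+* A) M M _ _ i3 i2 (AddHom.id M) (fun _ _ => rfl)
      exact (@LinearMap.isSimpleModule_iff_of_bijective _ _ _ _ _ _ i3 _ _ i2
        (f.symm : A →+* A) _ l Function.bijective_id).2 hs
    · intro a
      rw [RingEquiv.mapTwoSidedIdeal_apply, TwoSidedIdeal.mem_comap]
      exact hann _

end PrimitiveIdealSpace

/-! ## Alternating bicharacters and cocycle twists -/

/-- An alternating bicharacter `c : G × G → kˣ` on an (additively written) abelian group. -/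
structure AlternatingBicharacter (G : Type w) (k : Type u) [AddCommGroup G] [Field k] where
  toFun : G → G → kˣ
  add_left : ∀ x y z, toFun (x + y) z = toFun x z * toFun y z
  add_right : ∀ x y z, toFun x (y + z) = toFun x y * toFun x z
  self : ∀ x, toFun x x = 1

instance {G : Type w} {k : Type u} [AddCommGroup G] [Field k] :
    CoeFun (AlternatingBicharacter G k) (fun _ => G → G → kˣ) := ⟨AlternatingBicharacter.toFun⟩

theorem AlternatingBicharacter.zero_left {G : Type w} {k : Type u} [AddCommGroup G] [Field k]
    (c : AlternatingBicharacter G k) (y : G) : c 0 y = 1 := by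
  simpa using c.add_left 0 0 y

theorem AlternatingBicharacter.zero_right {G : Type w} {k : Type u} [AddCommGroup G] [Field k]
    (c : AlternatingBicharacter G k) (y : G) : c y 0 = 1 := by
  simpa using c.add_right y 0 0

section Graded

variable {k : Type u} {R : Type v} {G : Type w} [Field k] [Ring R] [Algebra k R]
  [AddCommGroup G] [DecidableEq G] (𝒜 : G → Submodule k R) [GradedAlgebra 𝒜]

/-- The `k`-linear map `R → R` which multiplies each homogeneous element of degree `x` by `f x`. -/
noncomputable def gradedScale (f : G → k) : R →ₗ[k] R :=
  (DirectSum.toModule k G R fun x => f x • (𝒜 x).subtype) ∘ₗ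
    (DirectSum.decomposeLinearEquiv 𝒜).toLinearMap

theorem gradedScale_of_mem (f : G → k) {x : G} {r : R} (hr : r ∈ 𝒜 x) :
    gradedScale 𝒜 f r = f x • r := by
  lift r to 𝒜 x using hr
  rw [gradedScale, LinearMap.comp_apply, LinearEquiv.coe_coe, DirectSum.decomposeLinearEquiv_apply,
    DirectSum.decompose_coe, ← DirectSum.lof_eq_of k, DirectSum.toModule_lof]
  rfl

/-- Multiplication on the twist of `R` by `c`: it is the bilinear map
with `(r, s) ↦ c x y • (r * s)` for `r` of degree `x` and `s` of degree `y`. -/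
noncomputable def twistMul (c : AlternatingBicharacter G k) : R →ₗ[k] R →ₗ[k] R :=
  (DirectSum.toModule k G (R →ₗ[k] R) fun x =>
      LinearMap.lcomp k R (gradedScale 𝒜 fun y => (c x y : k)) ∘ₗ LinearMap.mul k R ∘ₗ
        (𝒜 x).subtype) ∘ₗ
    (DirectSum.decomposeLinearEquiv 𝒜).toLinearMap

theorem twistMul_of_mem (c : AlternatingBicharacter G k) {x y : G} {r s : R}
    (hr : r ∈ 𝒜 x) (hs : s ∈ 𝒜 y) : twistMul 𝒜 c r s = (c x y : k) • (r * s) := by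
  lift r to 𝒜 x using hr
  rw [twistMul, LinearMap.comp_apply, LinearEquiv.coe_coe, DirectSum.decomposeLinearEquiv_apply,
    DirectSum.decompose_coe, ← DirectSum.lof_eq_of k, DirectSum.toModule_lof]
  change (r : R) * gradedScale 𝒜 (fun y => (c x y : k)) s = _
  rw [gradedScale_of_mem 𝒜 _ hs, mul_smul_comm]

/-- The twist `R'` of the `G`-graded algebra `R` by `c`: a copy of the `k`-vector space `R`, with
the multiplication `twistMul`. -/
@[nolint unusedArguments]
def CocycleTwist (_𝒜 : G → Submodule k R) (_c : AlternatingBicharacter G k) : Type v := R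

namespace CocycleTwist

variable (c : AlternatingBicharacter G k)

instance : AddCommGroup (CocycleTwist 𝒜 c) := inferInstanceAs (AddCommGroup R)

instance : Module k (CocycleTwist 𝒜 c) := inferInstanceAs (Module k R)

/-- The twist map `r ↦ r'`, a `k`-linear isomorphism from `R` onto `R'`. -/
def twist : R ≃ₗ[k] CocycleTwist 𝒜 c := LinearEquiv.refl k R

noncomputable instance : Mul (CocycleTwist 𝒜 c) :=
  ⟨fun a b => twist 𝒜 c (twistMul 𝒜 c ((twist 𝒜 c).symm a) ((twist 𝒜 c).symm b))⟩

instance : One (CocycleTwist 𝒜 c) := ⟨twist 𝒜 c 1⟩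

theorem twist_mul_twist (r s : R) :
    twist 𝒜 c r * twist 𝒜 c s = twist 𝒜 c (twistMul 𝒜 c r s) := rfl

/-- `r's' = c(x,y)(rs)'` for `r` and `s` homogeneous of degrees `x` and `y`. -/
theorem twist_mul_twist_of_mem {x y : G} {r s : R} (hr : r ∈ 𝒜 x) (hs : s ∈ 𝒜 y) :
    twist 𝒜 c r * twist 𝒜 c s = (c x y : k) • twist 𝒜 c (r * s) := by
  rw [twist_mul_twist, twistMul_of_mem 𝒜 c hr hs, map_smul]

theorem twistMul_one_left (r : R) : twistMul 𝒜 c 1 r = r := by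
  induction r using DirectSum.Decomposition.inductionOn 𝒜 with
  | zero => simp
  | homogeneous s =>
    rw [twistMul_of_mem 𝒜 c SetLike.GradedOne.one_mem s.2]
    simp [c.zero_left]
  | add r s hr hs => rw [map_add, hr, hs]

theorem twistMul_one_right (r : R) : twistMul 𝒜 c r 1 = r := by
  induction r using DirectSum.Decomposition.inductionOn 𝒜 with
  | zero => simp
  | homogeneous s =>
    rw [twistMul_of_mem 𝒜 c s.2 SetLike.GradedOne.one_mem]
    simp [c.zero_right]
  | add r s hr hs => rw [map_add, LinearMap.add_apply, hr, hs]

theorem twistMul_assoc (p q r : R) :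
    twistMul 𝒜 c (twistMul 𝒜 c p q) r = twistMul 𝒜 c p (twistMul 𝒜 c q r) := by
  induction p using DirectSum.Decomposition.inductionOn 𝒜 with
  | zero => simp
  | add a b ha hb => simp only [map_add, LinearMap.add_apply, ha, hb]
  | @homogeneous x a =>
    induction q using DirectSum.Decomposition.inductionOn 𝒜 with
    | zero => simp
    | add a b ha hb => simp only [map_add, LinearMap.add_apply, ha, hb]
    | @homogeneous y b =>
      induction r using DirectSum.Decomposition.inductionOn 𝒜 with
      | zero => simp
      | add a b ha hb => simp only [map_add, ha, hb]
      | @homogeneous z d =>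
        rw [twistMul_of_mem 𝒜 c a.2 b.2, twistMul_of_mem 𝒜 c b.2 d.2, map_smul, map_smul,
          LinearMap.smul_apply, twistMul_of_mem 𝒜 c (SetLike.GradedMul.mul_mem a.2 b.2) d.2,
          twistMul_of_mem 𝒜 c a.2 (SetLike.GradedMul.mul_mem b.2 d.2), smul_smul, smul_smul,
          c.add_left, c.add_right, mul_assoc]
        congr 1
        push_cast
        ring

noncomputable instance : Ring (CocycleTwist 𝒜 c) where
  __ := (inferInstance : AddCommGroup (CocycleTwist 𝒜 c))
  left_distrib a b d :=
    map_add (twistMul 𝒜 c ((twist 𝒜 c).symm a)) ((twist 𝒜 c).symm b) ((twist 𝒜 c).symm d)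
  right_distrib a b d :=
    LinearMap.map_add₂ (twistMul 𝒜 c) ((twist 𝒜 c).symm a) ((twist 𝒜 c).symm b)
      ((twist 𝒜 c).symm d)
  zero_mul a := LinearMap.map_zero₂ (twistMul 𝒜 c) ((twist 𝒜 c).symm a)
  mul_zero a := map_zero (twistMul 𝒜 c ((twist 𝒜 c).symm a))
  mul_assoc a b d :=
    twistMul_assoc 𝒜 c ((twist 𝒜 c).symm a) ((twist 𝒜 c).symm b) ((twist 𝒜 c).symm d)
  one_mul a := twistMul_one_left 𝒜 c ((twist 𝒜 c).symm a)
  mul_one a := twistMul_one_right 𝒜 c ((twist 𝒜 c).symm a)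

noncomputable instance : Algebra k (CocycleTwist 𝒜 c) :=
  Algebra.ofModule
    (fun t a b => LinearMap.map_smul₂ (twistMul 𝒜 c) t ((twist 𝒜 c).symm a) ((twist 𝒜 c).symm b))
    (fun t a b => map_smul (twistMul 𝒜 c ((twist 𝒜 c).symm a)) t ((twist 𝒜 c).symm b))

end CocycleTwist

/-! ## The group `H = Hom(G, kˣ)` and its actions

`AddChar G kˣ` is the group of homomorphisms from the additive group `G` to the multiplicative
group `kˣ`, under pointwise multiplication. -/

theorem gradedScale_char_one : gradedScale 𝒜 (fun x => ((1 : AddChar G kˣ) x : k)) = 1 := by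
  ext r
  induction r using DirectSum.Decomposition.inductionOn 𝒜 with
  | zero => simp
  | add a b ha hb => simp only [map_add, ha, hb]
  | homogeneous a => simp [gradedScale_of_mem 𝒜 _ a.2]

theorem gradedScale_char_mul (g h : AddChar G kˣ) (r : R) :
    gradedScale 𝒜 (fun x => ((g * h) x : k)) r =
      gradedScale 𝒜 (fun x => (g x : k)) (gradedScale 𝒜 (fun x => (h x : k)) r) := by
  induction r using DirectSum.Decomposition.inductionOn 𝒜 with
  | zero => simp
  | add a b ha hb => simp only [map_add, ha, hb]
  | homogeneous a =>
    simp [gradedScale_of_mem 𝒜 _ a.2, smul_smul, mul_comm]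

theorem gradedScale_twistMul (c : AlternatingBicharacter G k) (h : AddChar G kˣ) (r s : R) :
    gradedScale 𝒜 (fun x => (h x : k)) (twistMul 𝒜 c r s) =
      twistMul 𝒜 c (gradedScale 𝒜 (fun x => (h x : k)) r)
        (gradedScale 𝒜 (fun x => (h x : k)) s) := by
  induction r using DirectSum.Decomposition.inductionOn 𝒜 with
  | zero => simp
  | add a b ha hb => simp only [map_add, LinearMap.add_apply, ha, hb]
  | homogeneous a =>
    induction s using DirectSum.Decomposition.inductionOn 𝒜 with
    | zero => simp
    | add a b ha hb => simp only [map_add, ha, hb]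
    | homogeneous b =>
      rw [twistMul_of_mem 𝒜 c a.2 b.2, map_smul,
        gradedScale_of_mem 𝒜 _ (SetLike.GradedMul.mul_mem a.2 b.2),
        gradedScale_of_mem 𝒜 _ a.2, gradedScale_of_mem 𝒜 _ b.2, map_smul, map_smul,
        LinearMap.smul_apply, twistMul_of_mem 𝒜 c a.2 b.2, AddChar.map_add_eq_mul]
      simp only [smul_smul]
      congr 1
      push_cast
      ring

theorem gradedScale_mul (h : AddChar G kˣ) (r s : R) :
    gradedScale 𝒜 (fun x => (h x : k)) (r * s) =
      gradedScale 𝒜 (fun x => (h x : k)) r * gradedScale 𝒜 (fun x => (h x : k)) s := by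
  induction r using DirectSum.Decomposition.inductionOn 𝒜 with
  | zero => simp
  | add a b ha hb => simp only [map_add, add_mul, ha, hb]
  | homogeneous a =>
    induction s using DirectSum.Decomposition.inductionOn 𝒜 with
    | zero => simp
    | add a b ha hb => simp only [map_add, mul_add, ha, hb]
    | homogeneous b =>
      rw [gradedScale_of_mem 𝒜 _ (SetLike.GradedMul.mul_mem a.2 b.2),
        gradedScale_of_mem 𝒜 _ a.2, gradedScale_of_mem 𝒜 _ b.2, AddChar.map_add_eq_mul]
      rw [smul_mul_smul_comm]
      push_cast
      rfl

theorem gradedScale_char_inv_left (h : AddChar G kˣ) (r : R) :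
    gradedScale 𝒜 (fun x => (h⁻¹ x : k)) (gradedScale 𝒜 (fun x => (h x : k)) r) = r := by
  rw [← gradedScale_char_mul, inv_mul_cancel, gradedScale_char_one, Module.End.one_apply]

theorem gradedScale_char_inv_right (h : AddChar G kˣ) (r : R) :
    gradedScale 𝒜 (fun x => (h x : k)) (gradedScale 𝒜 (fun x => (h⁻¹ x : k)) r) = r := by
  rw [← gradedScale_char_mul, mul_inv_cancel, gradedScale_char_one, Module.End.one_apply]

/-- The automorphism of the algebra `R` given by `h ∈ H`: `h.r = h(x) r` for `r ∈ R_x`. -/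
noncomputable def charAut (h : AddChar G kˣ) : R ≃ₐ[k] R :=
  AlgEquiv.ofLinearEquiv
    { gradedScale 𝒜 (fun x => (h x : k)) with
      invFun := gradedScale 𝒜 (fun x => (h⁻¹ x : k))
      left_inv := gradedScale_char_inv_left 𝒜 h
      right_inv := gradedScale_char_inv_right 𝒜 h }
    (by
      change gradedScale 𝒜 (fun x => (h x : k)) 1 = 1
      rw [gradedScale_of_mem 𝒜 _ SetLike.GradedOne.one_mem]
      simp)
    (gradedScale_mul 𝒜 h)

theorem charAut_of_mem (h : AddChar G kˣ) {x : G} {r : R} (hr : r ∈ 𝒜 x) :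
    charAut 𝒜 h r = (h x : k) • r :=
  gradedScale_of_mem 𝒜 _ hr

/-- The automorphism of the twist given by `h ∈ H`: `h.r' = h(x) r'` for `r ∈ R_x`;
that is, `h.r' = (h.r)'` for all `r`. -/
noncomputable def charAutTwist (c : AlternatingBicharacter G k) (h : AddChar G kˣ) :
    CocycleTwist 𝒜 c ≃ₐ[k] CocycleTwist 𝒜 c :=
  AlgEquiv.ofLinearEquiv
    (((CocycleTwist.twist 𝒜 c).symm.trans (charAut 𝒜 h).toLinearEquiv).trans
      (CocycleTwist.twist 𝒜 c))
    (map_one (charAut 𝒜 h))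
    (gradedScale_twistMul 𝒜 c h)

theorem charAutTwist_of_mem (c : AlternatingBicharacter G k) (h : AddChar G kˣ) {x : G} {r : R}
    (hr : r ∈ 𝒜 x) :
    charAutTwist 𝒜 c h (CocycleTwist.twist 𝒜 c r) = (h x : k) • CocycleTwist.twist 𝒜 c r :=
  gradedScale_of_mem 𝒜 _ hr

end Graded

section Commutative

variable {k : Type u} {R : Type v} {G : Type w} [Field k] [CommRing R] [Algebra k R]
  [AddCommGroup G] [DecidableEq G] (𝒜 : G → Submodule k R) [GradedAlgebra 𝒜]

/-- The prime ideal `h(P)` of `R` (the preimage of `P` under the inverse of the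
automorphism `h`). -/
noncomputable def charSpec (h : AddChar G kˣ) (P : PrimeSpectrum R) : PrimeSpectrum R :=
  PrimeSpectrum.comap ((charAut 𝒜 h).symm : R →+* R) P

/-- The maximal ideal `h(M)` of `R`. -/
noncomputable def charMax (h : AddChar G kˣ) (M : MaximalSpectrum R) : MaximalSpectrum R where
  asIdeal := M.asIdeal.comap ((charAut 𝒜 h).symm : R →+* R)
  isMaximal :=
    have := M.isMaximal
    Ideal.comap_isMaximal_of_surjective _ (charAut 𝒜 h).symm.surjective

/-- `(P : T) = ⋂_{t ∈ T} t(P)` for an ideal `P` of `R` and a subgroup `T` of `H`. -/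
noncomputable def orbitInf (P : Ideal R) (T : Subgroup (AddChar G kˣ)) : Ideal R :=
  ⨅ t : T, P.map (charAut 𝒜 (t : AddChar G kˣ) : R →+* R)

/-- The `T`-orbit of a maximal ideal of `R`, for a subgroup `T` of `H`. -/
def maxOrbit (T : Subgroup (AddChar G kˣ)) (M : MaximalSpectrum R) : Set (MaximalSpectrum R) :=
  {N | ∃ t ∈ T, N = charMax 𝒜 t M}

/-- A finite sequence `r₁, …, rₙ` of homogeneous generators of the `k`-algebra `R`, where `rᵢ` is
of degree `δᵢ`. -/
structure HomogeneousGenerators (n : ℕ) where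
  gen : Fin n → R
  deg : Fin n → G
  gen_mem : ∀ i, gen i ∈ 𝒜 (deg i)
  adjoin_eq_top : Algebra.adjoin k (Set.range gen) = ⊤

namespace HomogeneousGenerators

variable {𝒜} {n : ℕ} (r : HomogeneousGenerators 𝒜 n) (W : Set (Fin n))

/-- `spec_w R = {P ∈ spec R | rᵢ ∈ P ↔ i ∈ w}`. -/
def specStratum : Set (PrimeSpectrum R) := {P | ∀ i, r.gen i ∈ P.asIdeal ↔ i ∈ W}

/-- `max_w R = max R ∩ spec_w R`. -/
def maxStratum : Set (MaximalSpectrum R) := {M | ∀ i, r.gen i ∈ M.asIdeal ↔ i ∈ W}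

/-- `prim_w A = {Q ∈ prim A | rᵢ' ∈ Q ↔ i ∈ w}`, where `A` is the twist of `R` by `c`. -/
def primStratum (c : AlternatingBicharacter G k) :
    Set (PrimitiveIdealSpace (CocycleTwist 𝒜 c)) :=
  {Q | ∀ i, CocycleTwist.twist 𝒜 c (r.gen i) ∈ Q.asIdeal ↔ i ∈ W}

/-- The subgroup `G_w` of `G` generated by the degrees `δᵢ` for `i ∉ w`. -/
def degreeSubgroup : AddSubgroup G := AddSubgroup.closure (r.deg '' Wᶜ)

/-- `rad(c_w) = {x ∈ G_w | c(x,y) = 1 for all y ∈ G_w}`, the radical of the restriction `c_w` of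
`c` to `G_w`. -/
def rad (c : AlternatingBicharacter G k) : Set G :=
  {x | x ∈ r.degreeSubgroup W ∧ ∀ y ∈ r.degreeSubgroup W, c x y = 1}

/-- `rad(c_w)^⊥ = {h ∈ H | h(x) = 1 for all x ∈ rad(c_w)}`. -/
def radPerp (c : AlternatingBicharacter G k) : Subgroup (AddChar G kˣ) where
  carrier := {h | ∀ x ∈ r.rad W c, h x = 1}
  one_mem' := fun _ _ => rfl
  mul_mem' := fun {g h} hg hh x hx => by rw [AddChar.mul_apply, hg x hx, hh x hx, one_mul]
  inv_mem' := fun {h} hh x hx => by rw [AddChar.inv_apply', hh x hx, inv_one]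

end HomogeneousGenerators

end Commutative

/-! Ideals of `A` are viewed as subspaces of `R`. If `r` is homogeneous of degree `x`, then `r's' =
(r · c(x,-).s)'`, so the two multiplications differ by the automorphisms of `R` given by the
characters `c(x,-)`. Let `L` be a subgroup of `G`. For a subspace stable under `c(y,-)`, `y ∈ L`,
and containing every homogeneous element of degree outside `L`, being an ideal of `R` and being an
ideal of `A` are the same thing.

For a prime `P` take `L` generated by the degrees of homogeneous elements outside `P`. The core of
`P`, the largest `c(L,-)`-stable ideal inside it, is then an ideal of `A`. It is the largest one in
`P`, because `r'a's'` with `r, s ∉ P` homogeneous involves an arbitrary translate `c(y,-).a`, `y ∈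
L`. This gives `φ_s`. By finite interpolation, stability under `c(L,-)` implies stability under
every character trivial on the radical of `c` on `L`; hence the formula with `rad(c_w)^⊥`.

Conversely, homogeneous elements of `A` are normal: passing `r'` of degree `x` past an element costs
the automorphism `c(2x,-)`. So a prime of `A` is stable under the characters `c(2x,-)` with `x` a
degree outside it. The hypothesis on `-1` says that these separate degrees as well as the `c(x,-)`
do, so the prime is an ideal of `R`; it is the core of a prime chosen by noetherianity
(`IsTwistPrime.exists_eq_biCore`). Most arguments reduce to elements supported on one coset of the
annihilator of `L`, where each `c(y,-)`, `y ∈ L`, is a scalar.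

For a maximal ideal with point `m : R → k`, two elements on the same coset are proportional modulo
the core. So a prime of `A` containing the core and no new generators equals it, and a suitable
functional yields a simple module whose annihilator is such a prime. Conversely, on a simple module,
quotients `u⁻¹e` of elements on one coset are endomorphisms, hence scalars by a Nullstellensatz for
`A` resting on generic freeness; so every primitive ideal is the core of a maximal ideal. If two
maximal ideals share a core, the ratios of their values on generators define a character modulo the
radical, which extends to `G` because `kˣ` is divisible. The quotient topology comes from the core
being an intersection of conjugates of `P` with the same core. -/

set_option linter.unusedSectionVars false

/-! ### Degreewise scalings and interpolation -/

section GradedScale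

open DirectSum

variable {k : Type u} {R : Type v} {G : Type w} [Field k] [Ring R] [Algebra k R]
  [AddCommGroup G] [DecidableEq G] (𝒜 : G → Submodule k R) [GradedAlgebra 𝒜]

theorem decompose_gradedScale (f : G → k) (r : R) (x : G) :
    (decompose 𝒜 (gradedScale 𝒜 f r) x : R) = f x • (decompose 𝒜 r x : R) := by
  induction r using DirectSum.Decomposition.inductionOn 𝒜 with
  | zero => simp
  | add a b ha hb =>
    rw [map_add, decompose_add, decompose_add, DirectSum.add_apply, DirectSum.add_apply, Submodule.coe_add,
      Submodule.coe_add, ha, hb, smul_add]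
  | @homogeneous y a =>
    rw [gradedScale_of_mem 𝒜 f a.2]
    rcases eq_or_ne y x with rfl | h
    · rw [decompose_of_mem_same 𝒜 ((𝒜 y).smul_mem _ a.2), decompose_of_mem_same 𝒜 a.2]
    · rw [decompose_of_mem_ne 𝒜 ((𝒜 y).smul_mem _ a.2) h, decompose_of_mem_ne 𝒜 a.2 h, smul_zero]

theorem decompose_ext {r s : R} (h : ∀ x, (decompose 𝒜 r x : R) = decompose 𝒜 s x) : r = s :=
  (decompose 𝒜).injective (DFinsupp.ext fun x => Subtype.ext (h x))

theorem gradedScale_congr {f g : G → k} {r : R}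
    (h : ∀ x, (decompose 𝒜 r x : R) ≠ 0 → f x = g x) :
    gradedScale 𝒜 f r = gradedScale 𝒜 g r := by
  apply decompose_ext 𝒜
  intro x
  rw [decompose_gradedScale, decompose_gradedScale]
  by_cases h0 : (decompose 𝒜 r x : R) = 0
  · rw [h0, smul_zero, smul_zero]
  · rw [h x h0]

/-- `gradedScale` as an algebra homomorphism. -/
noncomputable def gradedScaleHom : (G → k) →ₐ[k] Module.End k R where
  toFun := gradedScale 𝒜
  map_one' := LinearMap.ext fun r => decompose_ext 𝒜 fun x => by
    simp [decompose_gradedScale]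
  map_mul' f g := LinearMap.ext fun r => decompose_ext 𝒜 fun x => by
    simp [decompose_gradedScale, mul_smul]
  map_zero' := LinearMap.ext fun r => decompose_ext 𝒜 fun x => by
    simp [decompose_gradedScale]
  map_add' f g := LinearMap.ext fun r => decompose_ext 𝒜 fun x => by
    rw [decompose_gradedScale, LinearMap.add_apply, decompose_add, DirectSum.add_apply, Submodule.coe_add,
      decompose_gradedScale, decompose_gradedScale, Pi.add_apply, add_smul]
  commutes' a := LinearMap.ext fun r => decompose_ext 𝒜 fun x => by
    rw [decompose_gradedScale, Module.algebraMap_end_apply, decompose_smul, DirectSum.smul_apply,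
      Submodule.coe_smul]
    simp

theorem gradedScaleHom_apply (f : G → k) : gradedScaleHom 𝒜 f = gradedScale 𝒜 f := rfl

theorem gradedScale_add_apply (f g : G → k) (r : R) :
    gradedScale 𝒜 (f + g) r = gradedScale 𝒜 f r + gradedScale 𝒜 g r :=
  LinearMap.congr_fun (map_add (gradedScaleHom 𝒜) f g) r

theorem gradedScale_mul_apply (f g : G → k) (r : R) :
    gradedScale 𝒜 (f * g) r = gradedScale 𝒜 f (gradedScale 𝒜 g r) :=
  LinearMap.congr_fun (map_mul (gradedScaleHom 𝒜) f g) r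

theorem gradedScale_one_apply (r : R) : gradedScale 𝒜 1 r = r :=
  LinearMap.congr_fun (map_one (gradedScaleHom 𝒜)) r

theorem gradedScale_sum_apply {ι : Type*} (s : Finset ι) (f : ι → G → k) (r : R) :
    gradedScale 𝒜 (∑ i ∈ s, f i) r = ∑ i ∈ s, gradedScale 𝒜 (f i) r := by
  rw [← gradedScaleHom_apply, map_sum, LinearMap.sum_apply]
  rfl

/-- On a finite set, a function which does not separate more points than `F` does
is interpolated by an element of the algebra generated by `F`. -/
theorem exists_adjoin_eqOn {X : Type*} {k : Type*} [Field k] (F : Set (X → k)) (g : X → k)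
    (hg : ∀ x x', (∀ f ∈ F, f x = f x') → g x = g x') (s : Finset X) :
    ∃ f ∈ Algebra.adjoin k F, ∀ x ∈ s, f x = g x := by
  classical
  have hadj : ∀ f ∈ Algebra.adjoin k F, ∀ x x', (∀ f ∈ F, f x = f x') → f x = f x' := by
    intro f hf x x' h
    induction hf using Algebra.adjoin_induction with
    | mem f hf => exact h f hf
    | algebraMap a => rfl
    | add f₁ f₂ _ _ h₁ h₂ => simp [h₁, h₂]
    | mul f₁ f₂ _ _ h₁ h₂ => simp [h₁, h₂]
  induction s using Finset.induction_on with
  | empty => exact ⟨0, zero_mem _, by simp⟩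
  | insert x₀ s hx₀ ih =>
    obtain ⟨f, hf, hfs⟩ := ih
    by_cases hc : ∃ x ∈ s, ∀ φ ∈ F, φ x₀ = φ x
    · obtain ⟨x, hx, hφ⟩ := hc
      refine ⟨f, hf, fun y hy => ?_⟩
      rcases Finset.mem_insert.1 hy with rfl | hy
      · rw [hadj f hf _ x hφ, hfs x hx, hg _ x hφ]
      · exact hfs y hy
    · push Not at hc
      choose! φ hφF hφ using hc
      -- A Lagrange factor: it vanishes on `s` but not at `x₀`, so a multiple of it corrects `f` at
      -- `x₀` alone.
      let p : X → k := ∏ x ∈ s, (φ x - algebraMap k (X → k) (φ x x))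
      have hp : p ∈ Algebra.adjoin k F := Subalgebra.prod_mem _ fun x hx =>
        sub_mem (Algebra.subset_adjoin (hφF x hx)) (Subalgebra.algebraMap_mem _ _)
      have hp0 : p x₀ ≠ 0 := by
        simp only [p, Finset.prod_apply, Pi.sub_apply, Pi.algebraMap_apply, Algebra.algebraMap_self,
          RingHom.id_apply]
        exact Finset.prod_ne_zero_iff.2 fun x hx => sub_ne_zero.2 (hφ x hx)
      have hps : ∀ x ∈ s, p x = 0 := by
        intro x hx
        simp only [p, Finset.prod_apply, Pi.sub_apply, Pi.algebraMap_apply, Algebra.algebraMap_self,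
          RingHom.id_apply]
        exact Finset.prod_eq_zero hx (sub_self _)
      refine ⟨f + ((g x₀ - f x₀) / p x₀) • p, add_mem hf (Subalgebra.smul_mem _ hp _), ?_⟩
      intro y hy
      rcases Finset.mem_insert.1 hy with rfl | hy
      · simp [hp0]
      · simp [hps y hy, hfs y hy]

/-- A subspace stable under the scalings by elements of `F` is stable under each scaling which
separates no more degrees than `F` does. -/
theorem gradedScale_mem_of_separates {S : Submodule k R} (F : Set (G → k))
    (hF : ∀ f ∈ F, ∀ s ∈ S, gradedScale 𝒜 f s ∈ S) {g : G → k}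
    (hg : ∀ x x', (∀ f ∈ F, f x = f x') → g x = g x') {s : R} (hs : s ∈ S) :
    gradedScale 𝒜 g s ∈ S := by
  classical
  -- Only finitely many degrees occur in `s`, so on `s` the scaling by `g` agrees with one by a
  -- polynomial in elements of `F`.
  obtain ⟨f, hf, hfg⟩ := exists_adjoin_eqOn F g hg (DFinsupp.support (decompose 𝒜 s))
  have : gradedScale 𝒜 g s = gradedScale 𝒜 f s := by
    apply gradedScale_congr
    intro x hx
    exact (hfg x (DFinsupp.mem_support_iff.2 fun h => hx (by rw [h]; rfl))).symm
  rw [this]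
  clear this hfg
  induction hf using Algebra.adjoin_induction generalizing s with
  | mem f hf => exact hF f hf s hs
  | algebraMap a =>
    rw [← gradedScaleHom_apply, AlgHom.commutes, Module.algebraMap_end_apply]
    exact S.smul_mem _ hs
  | add f₁ f₂ _ _ h₁ h₂ =>
    rw [gradedScale_add_apply]
    exact add_mem (h₁ hs) (h₂ hs)
  | mul f₁ f₂ _ _ h₁ h₂ =>
    rw [gradedScale_mul_apply]
    exact h₁ (h₂ hs)

end GradedScale

/-! ### Characters and annihilators of an alternating bicharacter -/

namespace AlternatingBicharacter

variable {k : Type u} {G : Type w} [Field k] [AddCommGroup G] (c : AlternatingBicharacter G k)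

/-- The character `c(y, -)` of `G`. -/
def char (y : G) : AddChar G kˣ where
  toFun := c y
  map_zero_eq_one' := c.zero_right y
  map_add_eq_mul' := c.add_right y

theorem char_apply (y x : G) : c.char y x = c y x := rfl

theorem char_add (y z : G) : c.char (y + z) = c.char y * c.char z := by
  ext x
  simp [char_apply, c.add_left]

theorem char_zero : c.char 0 = 1 := by
  ext x
  simp [char_apply, c.zero_left]

theorem char_neg (y : G) : c.char (-y) = (c.char y)⁻¹ := by
  rw [eq_inv_iff_mul_eq_one, ← char_add, neg_add_cancel, char_zero]

theorem neg_left (x y : G) : c (-x) y = (c x y)⁻¹ := by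
  rw [eq_inv_iff_mul_eq_one, ← c.add_left, neg_add_cancel, c.zero_left]

theorem neg_right (x y : G) : c x (-y) = (c x y)⁻¹ := by
  rw [eq_inv_iff_mul_eq_one, ← c.add_right, neg_add_cancel, c.zero_right]

theorem sub_left (x y z : G) : c (x - y) z = c x z / c y z := by
  rw [sub_eq_add_neg, c.add_left, neg_left, div_eq_mul_inv]

theorem swap (x y : G) : c x y = (c y x)⁻¹ := by
  have h := c.self (x + y)
  rw [c.add_left, c.add_right, c.add_right, c.self, c.self, one_mul, mul_one] at h
  exact eq_inv_of_mul_eq_one_left h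

/-- The annihilator of a subgroup `L` of `G` with respect to `c`. -/
def perp (L : AddSubgroup G) : AddSubgroup G where
  carrier := {x | ∀ y ∈ L, c x y = 1}
  zero_mem' := fun y _ => c.zero_left y
  add_mem' := fun hx hx' y hy => by rw [c.add_left, hx y hy, hx' y hy, one_mul]
  neg_mem' := fun hx y hy => by rw [c.neg_left, hx y hy, inv_one]

theorem mem_perp {L : AddSubgroup G} {x : G} : x ∈ c.perp L ↔ ∀ y ∈ L, c x y = 1 := Iff.rfl

theorem eq_of_sub_mem_perp {L : AddSubgroup G} {x x' y : G} (h : x - x' ∈ c.perp L) (hy : y ∈ L) :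
    c y x = c y x' := by
  have := h y hy
  rw [c.sub_left, div_eq_one] at this
  rw [c.swap, this, ← c.swap]

theorem sub_mem_perp_iff {L : AddSubgroup G} {x x' : G} :
    x - x' ∈ c.perp L ↔ ∀ y ∈ L, c y x = c y x' := by
  refine ⟨fun h y hy => c.eq_of_sub_mem_perp h hy, fun h y hy => ?_⟩
  rw [c.sub_left, div_eq_one, c.swap, h y hy, ← c.swap]

/-- The hypothesis on `-1` acts through this statement: a value of `c` with square 1 is `1` or `-1`,
and `-1` is either excluded or equal to 1. It allows the characters `c(2x,-)` to replace the
`c(x,-)` when separating degrees. -/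
theorem eq_one_of_sq_eq_one
    (hc : (-1 : kˣ) ∉ Subgroup.closure (Set.range fun p : G × G => c p.1 p.2) ∨ CharP k 2)
    {x y : G} (h : c x y ^ 2 = 1) : c x y = 1 := by
  have h' : (c x y : k) ^ 2 = 1 := by rw [← Units.val_pow_eq_pow_val, h, Units.val_one]
  rcases sq_eq_one_iff.1 h' with h1 | h1
  · exact Units.ext h1
  · rcases hc with hc | hc
    · have : c x y = -1 := Units.ext (by simpa using h1)
      exact absurd (this ▸ Subgroup.subset_closure ⟨(x, y), rfl⟩) hc
    · rw [CharTwo.neg_eq] at h1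
      exact Units.ext h1

end AlternatingBicharacter

/-! ### Comparison of ideals of `R` and of the twist -/

section Twist

open DirectSum

variable {k : Type u} {R : Type v} {G : Type w} [Field k] [CommRing R] [Algebra k R]
  [AddCommGroup G] [DecidableEq G] (𝒜 : G → Submodule k R) [GradedAlgebra 𝒜]
  (c : AlternatingBicharacter G k)

/-- The action on `R` of the character `c(y, -)`. -/
noncomputable def biScale (y : G) : R →ₗ[k] R := gradedScale 𝒜 fun x => (c y x : k)

theorem biScale_of_mem (y : G) {x : G} {r : R} (hr : r ∈ 𝒜 x) :
    biScale 𝒜 c y r = (c y x : k) • r := gradedScale_of_mem 𝒜 _ hr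

theorem biScale_mul (y : G) (r s : R) :
    biScale 𝒜 c y (r * s) = biScale 𝒜 c y r * biScale 𝒜 c y s :=
  gradedScale_mul 𝒜 (c.char y) r s

theorem biScale_add (y z : G) (r : R) :
    biScale 𝒜 c (y + z) r = biScale 𝒜 c y (biScale 𝒜 c z r) := by
  rw [biScale, biScale, biScale, ← gradedScale_mul_apply]
  congr 2
  ext x
  simp [c.add_left]

theorem biScale_zero (r : R) : biScale 𝒜 c 0 r = r := by
  rw [biScale, show (fun x => (c 0 x : k)) = 1 from funext fun x => by simp [c.zero_left],
    gradedScale_one_apply]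

theorem biScale_neg_biScale (y : G) (r : R) : biScale 𝒜 c (-y) (biScale 𝒜 c y r) = r := by
  rw [← biScale_add, neg_add_cancel, biScale_zero]

theorem biScale_biScale_neg (y : G) (r : R) : biScale 𝒜 c y (biScale 𝒜 c (-y) r) = r := by
  rw [← biScale_add, add_neg_cancel, biScale_zero]

/-- With one homogeneous factor, the twisted product is the ordinary one after an automorphism of
`R`. This and its mirror image below are the bridge between the two ideal theories. -/
theorem twistMul_eq_mul_biScale {x : G} {r : R} (hr : r ∈ 𝒜 x) (s : R) :
    twistMul 𝒜 c r s = r * biScale 𝒜 c x s := by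
  induction s using DirectSum.Decomposition.inductionOn 𝒜 with
  | zero => simp
  | add a b ha hb => rw [map_add, map_add, mul_add, ha, hb]
  | homogeneous a =>
    rw [twistMul_of_mem 𝒜 c hr a.2, biScale_of_mem 𝒜 c x a.2, mul_smul_comm]

theorem twistMul_eq_biScale_neg_mul {y : G} (r : R) {s : R} (hs : s ∈ 𝒜 y) :
    twistMul 𝒜 c r s = biScale 𝒜 c (-y) r * s := by
  induction r using DirectSum.Decomposition.inductionOn 𝒜 with
  | zero => simp
  | add a b ha hb => rw [map_add, map_add, add_mul, LinearMap.add_apply, ha, hb]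
  | homogeneous a =>
    rw [twistMul_of_mem 𝒜 c a.2 hs, biScale_of_mem 𝒜 c (-y) a.2, smul_mul_assoc, c.swap,
      c.neg_left]

theorem mul_eq_twistMul_biScale_neg {x : G} {r : R} (hr : r ∈ 𝒜 x) (s : R) :
    r * s = twistMul 𝒜 c r (biScale 𝒜 c (-x) s) := by
  rw [twistMul_eq_mul_biScale 𝒜 c hr, biScale_biScale_neg]

/-- Homogeneous elements are normal in the twist. -/
theorem twistMul_comm_of_mem {x : G} {r : R} (hr : r ∈ 𝒜 x) (s : R) :
    twistMul 𝒜 c s r = twistMul 𝒜 c r (biScale 𝒜 c (-(x + x)) s) := by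
  rw [twistMul_eq_biScale_neg_mul 𝒜 c s hr, mul_comm, mul_eq_twistMul_biScale_neg 𝒜 c hr,
    ← biScale_add, neg_add]

variable {𝒜} {c}

/-- `S` corresponds to a two-sided ideal of the twist. -/
def IsTwistIdeal (𝒜 : G → Submodule k R) [GradedAlgebra 𝒜] (c : AlternatingBicharacter G k)
    (S : Submodule k R) : Prop :=
  ∀ s ∈ S, ∀ r, twistMul 𝒜 c r s ∈ S ∧ twistMul 𝒜 c s r ∈ S

/-- `S` is an ideal of `R`, as a property of a subspace. -/
def IsMulIdeal (S : Submodule k R) : Prop := ∀ s ∈ S, ∀ r, r * s ∈ S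

/-- `S` is stable under the characters `c(y, -)` with `y ∈ L`. -/
def IsBiStable (𝒜 : G → Submodule k R) [GradedAlgebra 𝒜] (c : AlternatingBicharacter G k)
    (L : AddSubgroup G) (S : Submodule k R) : Prop :=
  ∀ y ∈ L, ∀ s ∈ S, biScale 𝒜 c y s ∈ S

/-- `S` contains all homogeneous elements whose degree is not in `L`. -/
def IsFullOutside (𝒜 : G → Submodule k R) (L : AddSubgroup G) (S : Submodule k R) : Prop :=
  ∀ x ∉ L, 𝒜 x ≤ S

variable {L : AddSubgroup G} {S : Submodule k R}

/-- It suffices to multiply by homogeneous elements. If the degree is in `L`, the correcting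
automorphism preserves `S`; if not, the factor itself already lies in `S`. The converse below has
the same two cases. -/
theorem IsMulIdeal.isTwistIdeal (hS : IsMulIdeal S) (hst : IsBiStable 𝒜 c L S)
    (hf : IsFullOutside 𝒜 L S) : IsTwistIdeal 𝒜 c S := by
  intro s hs r
  induction r using DirectSum.Decomposition.inductionOn 𝒜 with
  | zero => simp
  | add a b ha hb =>
    rw [map_add, map_add, LinearMap.add_apply]
    exact ⟨add_mem ha.1 hb.1, add_mem ha.2 hb.2⟩
  | @homogeneous x a =>
    rw [twistMul_eq_mul_biScale 𝒜 c a.2, twistMul_eq_biScale_neg_mul 𝒜 c s a.2]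
    by_cases hx : x ∈ L
    · refine ⟨hS _ (hst x hx s hs) _, ?_⟩
      rw [mul_comm]
      exact hS _ (hst (-x) (neg_mem hx) s hs) _
    · refine ⟨?_, hS _ (hf x hx a.2) _⟩
      rw [mul_comm]
      exact hS _ (hf x hx a.2) _

theorem IsTwistIdeal.isMulIdeal (hS : IsTwistIdeal 𝒜 c S) (hst : IsBiStable 𝒜 c L S)
    (hf : IsFullOutside 𝒜 L S) : IsMulIdeal S := by
  intro s hs r
  induction r using DirectSum.Decomposition.inductionOn 𝒜 with
  | zero => simp
  | add a b ha hb =>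
    rw [add_mul]
    exact add_mem ha hb
  | @homogeneous x a =>
    rw [mul_eq_twistMul_biScale_neg 𝒜 c a.2]
    by_cases hx : x ∈ L
    · exact (hS _ (hst (-x) (neg_mem hx) s hs) _).1
    · exact (hS _ (hf x hx a.2) _).2

/-- If `r` is homogeneous, the ideal `rR` of `R` is the ideal of the twist generated by `r`. -/
theorem IsTwistIdeal.mul_mem_of_mem (hS : IsTwistIdeal 𝒜 c S) {x : G} {r : R} (hr : r ∈ 𝒜 x)
    (h : r ∈ S) (s : R) : r * s ∈ S := by
  rw [mul_eq_twistMul_biScale_neg 𝒜 c hr]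
  exact (hS r h _).2

theorem IsFullOutside.gradedScale_mem (hf : IsFullOutside 𝒜 L S) {g : G → k}
    (hg : ∀ x ∈ L, g x = 0) (s : R) : gradedScale 𝒜 g s ∈ S := by
  induction s using DirectSum.Decomposition.inductionOn 𝒜 with
  | zero => simp
  | add a b ha hb => rw [map_add]; exact add_mem ha hb
  | @homogeneous x a =>
    rw [gradedScale_of_mem 𝒜 _ a.2]
    by_cases hx : x ∈ L
    · rw [hg x hx, zero_smul]
      exact zero_mem _
    · exact S.smul_mem _ (hf x hx a.2)

/-- A stable subspace is stable under all scalings by functions which, on `L`, only depend on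
the class modulo the annihilator of `L`. -/
theorem IsBiStable.gradedScale_mem (hst : IsBiStable 𝒜 c L S) (hf : IsFullOutside 𝒜 L S)
    {g : G → k} (hg : ∀ x ∈ L, ∀ x' ∈ L, x - x' ∈ c.perp L → g x = g x') {s : R} (hs : s ∈ S) :
    gradedScale 𝒜 g s ∈ S := by
  classical
  -- Fullness makes degrees outside `L` harmless, so `S` is stable under the indicator of `L`.
  -- Adding it to the separating functions leaves only pairs of degrees inside `L` to be compared.
  let e : G → k := fun x => if x ∈ L then 1 else 0
  have h1 : ∀ f : G → k, f = e * f + (1 - e) * f := fun f => by ring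
  have h2 : ∀ (f : G → k) s, gradedScale 𝒜 ((1 - e) * f) s ∈ S := fun f s =>
    hf.gradedScale_mem (fun x hx => by simp [e, hx]) s
  have he : ∀ s ∈ S, gradedScale 𝒜 e s ∈ S := fun s hs => by
    have h3 := h2 1 s
    rw [mul_one, sub_eq_add_neg, gradedScale_add_apply, gradedScale_one_apply] at h3
    have h4 := (S.add_mem_iff_right hs).1 h3
    rw [← gradedScaleHom_apply, map_neg, LinearMap.neg_apply, neg_mem_iff] at h4
    exact h4
  rw [h1 g, gradedScale_add_apply]
  refine add_mem ?_ (h2 _ _)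
  refine gradedScale_mem_of_separates 𝒜 (insert e ((fun y x => (c y x : k)) '' (L : Set G))) ?_ ?_ hs
  · rintro f (rfl | ⟨y, hy, rfl⟩) s hs
    · exact he s hs
    · exact hst y hy s hs
  · intro x x' h
    have hee := h e (Set.mem_insert _ _)
    by_cases hx : x ∈ L
    · have hx' : x' ∈ L := by
        by_contra hx'
        simp [e, hx, hx'] at hee
      rw [Pi.mul_apply, Pi.mul_apply, hee, hg x hx x' hx']
      refine c.sub_mem_perp_iff.2 fun y hy => Units.ext ?_
      exact h _ (Set.mem_insert_of_mem _ ⟨y, hy, rfl⟩)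
    · have hx0 : e x = 0 := by simp [e, hx]
      rw [Pi.mul_apply, Pi.mul_apply, ← hee, hx0, zero_mul, zero_mul]

/-- All degrees of `a` are congruent to `h` modulo the annihilator of `L`. -/
def InCoset (𝒜 : G → Submodule k R) [GradedAlgebra 𝒜] (c : AlternatingBicharacter G k)
    (L : AddSubgroup G) (h : G) (a : R) : Prop :=
  ∀ x, (decompose 𝒜 a x : R) ≠ 0 → x - h ∈ c.perp L

theorem InCoset.biScale_eq {h : G} {a : R} (ha : InCoset 𝒜 c L h a) {y : G} (hy : y ∈ L) :
    biScale 𝒜 c y a = (c y h : k) • a := by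
  rw [biScale, gradedScale_congr 𝒜 (g := algebraMap k (G → k) (c y h)), ← gradedScaleHom_apply,
    AlgHom.commutes, Module.algebraMap_end_apply]
  intro x hx
  rw [c.eq_of_sub_mem_perp (ha x hx) hy]
  rfl

theorem InCoset.of_mem {x : G} {a : R} (ha : a ∈ 𝒜 x) : InCoset 𝒜 c L x a := by
  intro y hy
  rcases eq_or_ne x y with rfl | h
  · rw [sub_self]
    exact zero_mem _
  · exact absurd (decompose_of_mem_ne 𝒜 ha h) hy

theorem InCoset.sub {h : G} {a b : R} (ha : InCoset 𝒜 c L h a) (hb : InCoset 𝒜 c L h b) :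
    InCoset 𝒜 c L h (a - b) := by
  intro x hx
  by_contra hn
  rw [decompose_sub, DirectSum.sub_apply, Submodule.coe_sub, not_imp_comm.1 (ha x) hn,
    not_imp_comm.1 (hb x) hn, sub_zero] at hx
  exact hx rfl

theorem InCoset.smul {h : G} {a : R} (ha : InCoset 𝒜 c L h a) (t : k) :
    InCoset 𝒜 c L h (t • a) := by
  intro x hx
  by_contra hn
  rw [decompose_smul, DirectSum.smul_apply, Submodule.coe_smul, not_imp_comm.1 (ha x) hn,
    smul_zero] at hx
  exact hx rfl

theorem InCoset.of_sub_mem {h h' : G} {a : R} (ha : InCoset 𝒜 c L h a) (hh : h - h' ∈ c.perp L) :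
    InCoset 𝒜 c L h' a := by
  intro x hx
  simpa using add_mem (ha x hx) hh

/-- A stable subspace is spanned by elements supported on one coset and by homogeneous elements
of degrees outside `L`. -/
theorem IsBiStable.induction (hst : IsBiStable 𝒜 c L S) (hf : IsFullOutside 𝒜 L S) {T : Submodule k R}
    (hT : IsFullOutside 𝒜 L T)
    (hco : ∀ h ∈ L, ∀ a ∈ S, InCoset 𝒜 c L h a → a ∈ T) : S ≤ T := by
  classical
  intro s hs
  -- `s` is cut along the classes modulo `c.perp L` of its degrees in `L`. Each such degree is
  -- counted in exactly one class, so the remainder has all its degrees outside `L`.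
  let F := (DFinsupp.support (decompose 𝒜 s)).filter (· ∈ L)
  let Q := F.image (QuotientAddGroup.mk (s := c.perp L))
  let e : G ⧸ c.perp L → G → k := fun q x => if QuotientAddGroup.mk x = q then 1 else 0
  have hsum : s = ∑ q ∈ Q, gradedScale 𝒜 (e q) s + gradedScale 𝒜 (1 - ∑ q ∈ Q, e q) s := by
    rw [← gradedScale_sum_apply, ← gradedScale_add_apply, add_sub_cancel, gradedScale_one_apply]
  rw [hsum]
  refine add_mem (Submodule.sum_mem _ fun q hq => ?_) ?_
  · obtain ⟨h, hh, rfl⟩ := Finset.mem_image.1 hq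
    have hhL := (Finset.mem_filter.1 hh).2
    refine hco h hhL _ (hst.gradedScale_mem hf ?_ hs) ?_
    · intro x _ x' _ hxx
      have : (QuotientAddGroup.mk x : G ⧸ c.perp L) = QuotientAddGroup.mk x' := by
        rw [QuotientAddGroup.eq, neg_add_eq_sub, ← neg_sub, neg_mem_iff]
        exact hxx
      simp only [e, this]
    · intro x hx
      rw [decompose_gradedScale] at hx
      have hxh : (QuotientAddGroup.mk x : G ⧸ c.perp L) = QuotientAddGroup.mk h := by
        by_contra hne
        simp [e, hne] at hx
      rw [QuotientAddGroup.eq, neg_add_eq_sub, ← neg_sub, neg_mem_iff] at hxh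
      exact hxh
  · rw [gradedScale_congr 𝒜 (g := fun x => if x ∈ L then 0 else (1 - ∑ q ∈ Q, e q) x)]
    · exact hT.gradedScale_mem (fun x hx => by simp [hx]) s
    · intro x hx
      split_ifs with hxL
      · have hxF : x ∈ F := Finset.mem_filter.2
          ⟨DFinsupp.mem_support_iff.2 fun h => hx (by rw [h]; rfl), hxL⟩
        simp [e, Finset.sum_apply, Q, Finset.mem_image_of_mem _ hxF]
      · rfl

/-- Modulo an ideal which is full outside `L`, the two products by an element supported on one
coset agree up to a character. -/
theorem InCoset.twistMul_sub_mul_mem {K : Submodule k R} (hK : IsMulIdeal K)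
    (hf : IsFullOutside 𝒜 L K) {h : G} {a : R} (ha : InCoset 𝒜 c L h a) (b : R) :
    twistMul 𝒜 c a b - a * biScale 𝒜 c h b ∈ K := by
  induction b using DirectSum.Decomposition.inductionOn 𝒜 with
  | zero => simp
  | add b b' hb hb' =>
    rw [map_add, map_add, mul_add, add_sub_add_comm]
    exact add_mem hb hb'
  | @homogeneous y b =>
    rw [twistMul_eq_biScale_neg_mul 𝒜 c a b.2, biScale_of_mem 𝒜 c h b.2]
    by_cases hy : y ∈ L
    · rw [ha.biScale_eq (neg_mem hy), smul_mul_assoc, mul_smul_comm, c.swap, c.neg_right, inv_inv,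
        sub_self]
      exact zero_mem _
    · rw [mul_smul_comm]
      exact sub_mem (hK _ (hf y hy b.2) _) (K.smul_mem _ (hK _ (hf y hy b.2) _))

/-- An ideal of the twist modulo which, for each `x ∈ M`, some homogeneous element of degree `x`
is left regular, is stable under `c(y, -)` for `y` in the subgroup generated by `M`. -/
theorem IsTwistIdeal.isBiStable
    (hc : (-1 : kˣ) ∉ Subgroup.closure (Set.range fun p : G × G => c p.1 p.2) ∨ CharP k 2)
    (hS : IsTwistIdeal 𝒜 c S) {M : Set G}
    (hM : ∀ x ∈ M, ∃ r ∈ 𝒜 x, ∀ u, twistMul 𝒜 c r u ∈ S → u ∈ S) :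
    IsBiStable 𝒜 c (AddSubgroup.closure M) S := by
  intro y hy s hs
  -- Normality of `r` gives `s'r' = r'(c(-2x,-).s)'`, and cancelling `r` shows stability under
  -- `c(-2x,-)`. These characters are enough to interpolate `c(y,-)`.
  refine gradedScale_mem_of_separates 𝒜 ((fun x z => (c (-(x + x)) z : k)) '' M) ?_ ?_ hs
  · rintro _ ⟨x, hx, rfl⟩ s hs
    obtain ⟨r, hr, hru⟩ := hM x hx
    refine hru _ ?_
    have := (hS s hs r).2
    rwa [twistMul_comm_of_mem 𝒜 c hr] at this
  · intro z z' h
    refine congrArg Units.val ((c.sub_mem_perp_iff (L := AddSubgroup.closure M)).1 (?_ : z - z' ∈ _) y hy)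
    intro y hy
    induction hy using AddSubgroup.closure_induction with
    | mem x hx =>
      -- That `c(-2x,-)` agrees at `z` and `z'` says exactly that `c(z - z', x)` has square 1.
      refine c.eq_one_of_sq_eq_one hc ?_
      have hz := Units.ext (h _ ⟨x, hx, rfl⟩)
      rw [c.neg_left, c.neg_left, inv_inj, c.add_left, c.add_left, ← sq, ← sq] at hz
      rw [c.sub_left, c.swap z, c.swap z', div_pow, inv_pow, inv_pow, hz, div_self']
    | zero => exact c.zero_right _
    | add a b _ _ ha hb => rw [c.add_right, ha, hb, one_mul]
    | neg a _ ha => rw [c.neg_right, ha, inv_one]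

end Twist

/-! ### Prime ideals of the twist are the cores of primes of `R` -/

section Twist

open DirectSum

variable {k : Type u} {R : Type v} {G : Type w} [Field k] [CommRing R] [Algebra k R]
  [AddCommGroup G] [DecidableEq G] {𝒜 : G → Submodule k R} [GradedAlgebra 𝒜]
  {c : AlternatingBicharacter G k}

/-- The two-sided ideal `S'` of the twist. -/
noncomputable def IsTwistIdeal.toTwoSidedIdeal {S : Submodule k R} (hS : IsTwistIdeal 𝒜 c S) :
    TwoSidedIdeal (CocycleTwist 𝒜 c) :=
  TwoSidedIdeal.mk' {a | (CocycleTwist.twist 𝒜 c).symm a ∈ S} S.zero_mem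
    (fun hx hy => S.add_mem hx hy) (fun hx => S.neg_mem hx) (fun hy => (hS _ hy _).1)
    (fun hx => (hS _ hx _).2)

theorem IsTwistIdeal.mem_toTwoSidedIdeal {S : Submodule k R} (hS : IsTwistIdeal 𝒜 c S)
    {a : CocycleTwist 𝒜 c} :
    a ∈ hS.toTwoSidedIdeal ↔ (CocycleTwist.twist 𝒜 c).symm a ∈ S := by
  unfold toTwoSidedIdeal
  exact TwoSidedIdeal.mem_mk' ..

/-- The subspace of `R` corresponding to a two-sided ideal of the twist. -/
def TwoSidedIdeal.untwist (I : TwoSidedIdeal (CocycleTwist 𝒜 c)) : Submodule k R where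
  carrier := {r | CocycleTwist.twist 𝒜 c r ∈ I}
  zero_mem' := I.zero_mem
  add_mem' ha hb := I.add_mem ha hb
  smul_mem' t r hr := by
    have h := I.mul_mem_left (algebraMap k _ t) (CocycleTwist.twist 𝒜 c r) hr
    rw [← Algebra.smul_def] at h
    exact h

theorem TwoSidedIdeal.mem_untwist {I : TwoSidedIdeal (CocycleTwist 𝒜 c)} {r : R} :
    r ∈ I.untwist ↔ CocycleTwist.twist 𝒜 c r ∈ I := Iff.rfl

theorem TwoSidedIdeal.isTwistIdeal_untwist (I : TwoSidedIdeal (CocycleTwist 𝒜 c)) :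
    IsTwistIdeal 𝒜 c I.untwist := fun s hs r =>
  ⟨I.mul_mem_left (CocycleTwist.twist 𝒜 c r) (CocycleTwist.twist 𝒜 c s) hs,
    I.mul_mem_right (CocycleTwist.twist 𝒜 c s) (CocycleTwist.twist 𝒜 c r) hs⟩

theorem TwoSidedIdeal.untwist_le_untwist {I J : TwoSidedIdeal (CocycleTwist 𝒜 c)} :
    I.untwist ≤ J.untwist ↔ I ≤ J :=
  ⟨fun h a ha => h (x := (CocycleTwist.twist 𝒜 c).symm a) ha, fun h _ hr => h hr⟩

theorem IsTwistIdeal.untwist_toTwoSidedIdeal {S : Submodule k R} (hS : IsTwistIdeal 𝒜 c S) :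
    hS.toTwoSidedIdeal.untwist = S := by
  ext r
  rw [TwoSidedIdeal.mem_untwist, hS.mem_toTwoSidedIdeal, LinearEquiv.symm_apply_apply]

theorem TwoSidedIdeal.untwist_injective :
    Function.Injective (TwoSidedIdeal.untwist : TwoSidedIdeal (CocycleTwist 𝒜 c) → _) :=
  fun _ _ h => le_antisymm (untwist_le_untwist.1 h.le) (untwist_le_untwist.1 h.ge)

/-- `S` corresponds to a prime ideal of the twist. -/
structure IsTwistPrime (𝒜 : G → Submodule k R) [GradedAlgebra 𝒜] (c : AlternatingBicharacter G k)
    (S : Submodule k R) : Prop where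
  isTwistIdeal : IsTwistIdeal 𝒜 c S
  one_notMem : (1 : R) ∉ S
  mem_or_mem : ∀ a b, (∀ r, twistMul 𝒜 c a (twistMul 𝒜 c r b) ∈ S) → a ∈ S ∨ b ∈ S

/-- Passage from ideals to elements: with `J` the ideal of all `y` such that `aAy ⊆ P`, and `I` the
ideal of all `x` such that `xJ ⊆ P`, one has `IJ ⊆ P`, `a ∈ I` and `b ∈ J`. -/
theorem TwoSidedIdeal.IsPrimeIdeal.mem_or_mem {A : Type u} [Ring A] {P : TwoSidedIdeal A}
    (hP : P.IsPrimeIdeal) {a b : A} (h : ∀ r, a * (r * b) ∈ P) : a ∈ P ∨ b ∈ P := by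
  let J : TwoSidedIdeal A := TwoSidedIdeal.mk' {y | ∀ r, a * (r * y) ∈ P}
    (fun r => by simp)
    (fun {x y} hx hy r => by rw [mul_add, mul_add]; exact P.add_mem (hx r) (hy r))
    (fun {x} hx r => by rw [mul_neg, mul_neg]; exact P.neg_mem (hx r))
    (fun {x y} hy r => by rw [← mul_assoc r]; exact hy _)
    (fun {x y} hx r => by rw [← mul_assoc, ← mul_assoc]
                          exact P.mul_mem_right _ _ (by rw [mul_assoc]; exact hx r))
  have hJ : ∀ y, y ∈ J ↔ ∀ r, a * (r * y) ∈ P := fun y => by rw [TwoSidedIdeal.mem_mk']; rfl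
  let I : TwoSidedIdeal A := TwoSidedIdeal.mk' {x | ∀ y ∈ J, x * y ∈ P}
    (fun y _ => by simp)
    (fun {x x'} hx hx' y hy => by rw [add_mul]; exact P.add_mem (hx y hy) (hx' y hy))
    (fun {x} hx y hy => by rw [neg_mul]; exact P.neg_mem (hx y hy))
    (fun {x x'} hx' y hy => by rw [mul_assoc]; exact P.mul_mem_left _ _ (hx' y hy))
    (fun {x x'} hx y hy => by rw [mul_assoc]; exact hx _ (J.mul_mem_left _ _ hy))
  have hI : ∀ x, x ∈ I ↔ ∀ y ∈ J, x * y ∈ P := fun y => by rw [TwoSidedIdeal.mem_mk']; rfl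
  refine (hP.le_or_le I J fun x hx y hy => (hI x).1 hx y hy).imp (fun h' => h' ?_) (fun h' => h' ?_)
  · rw [hI]
    intro y hy
    simpa using (hJ y).1 hy 1
  · rwa [hJ]

theorem TwoSidedIdeal.IsPrimeIdeal.isTwistPrime {I : TwoSidedIdeal (CocycleTwist 𝒜 c)}
    (hI : I.IsPrimeIdeal) : IsTwistPrime 𝒜 c I.untwist where
  isTwistIdeal := I.isTwistIdeal_untwist
  one_notMem h := hI.ne_top (I.one_mem_iff.1 h)
  mem_or_mem a b h := hI.mem_or_mem (a := CocycleTwist.twist 𝒜 c a) (b := CocycleTwist.twist 𝒜 c b)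
    fun r => h ((CocycleTwist.twist 𝒜 c).symm r)

theorem IsTwistPrime.isPrimeIdeal {S : Submodule k R} (hS : IsTwistPrime 𝒜 c S) :
    hS.isTwistIdeal.toTwoSidedIdeal.IsPrimeIdeal where
  ne_top h := hS.one_notMem (by
    have := (TwoSidedIdeal.one_mem_iff _).2 h
    rwa [hS.isTwistIdeal.mem_toTwoSidedIdeal] at this)
  le_or_le I J h := by
    by_contra hc
    obtain ⟨h1, h2⟩ := not_or.1 hc
    obtain ⟨a, haI, haP⟩ := SetLike.not_le_iff_exists.1 h1
    obtain ⟨b, hbJ, hbP⟩ := SetLike.not_le_iff_exists.1 h2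
    rw [hS.isTwistIdeal.mem_toTwoSidedIdeal] at haP hbP
    refine (hS.mem_or_mem _ _ fun r => ?_).elim haP hbP
    exact hS.isTwistIdeal.mem_toTwoSidedIdeal.1
      (h a haI (CocycleTwist.twist 𝒜 c r * b) (J.mul_mem_left _ _ hbJ))

/-- The set of degrees of homogeneous elements outside `S`. -/
def degSet (𝒜 : G → Submodule k R) (S : Submodule k R) : Set G := {x | ∃ r ∈ 𝒜 x, r ∉ S}

/-- The subgroup generated by the degrees of homogeneous elements outside `S`. -/
def degGroup (𝒜 : G → Submodule k R) (S : Submodule k R) : AddSubgroup G :=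
  AddSubgroup.closure (degSet 𝒜 S)

theorem isFullOutside_degGroup (S : Submodule k R) : IsFullOutside 𝒜 (degGroup 𝒜 S) S := by
  intro x hx r hr
  by_contra h
  exact hx (AddSubgroup.subset_closure ⟨r, hr, h⟩)

theorem IsFullOutside.mono {S T : Submodule k R} {L : AddSubgroup G} (hS : IsFullOutside 𝒜 L S)
    (h : S ≤ T) : IsFullOutside 𝒜 L T := fun x hx => (hS x hx).trans h

theorem biScale_mem_of_mem {S : Submodule k R} (y : G) {x : G} {r : R} (hr : r ∈ 𝒜 x)
    (h : r ∈ S) : biScale 𝒜 c y r ∈ S := by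
  rw [biScale_of_mem 𝒜 c y hr]
  exact S.smul_mem _ h

theorem biScale_mem_iff_of_mem {S : Submodule k R} {y : G} {x : G} {r : R} (hr : r ∈ 𝒜 x) :
    biScale 𝒜 c y r ∈ S ↔ r ∈ S := by
  refine ⟨fun h => ?_, biScale_mem_of_mem y hr⟩
  rw [biScale_of_mem 𝒜 c y hr] at h
  exact (S.smul_mem_iff (c y x).ne_zero).1 h

variable (𝒜 c) in
/-- The largest ideal contained in `P` which is stable under the characters `c(y, -)`, `y ∈ L`. -/
def biCore (L : AddSubgroup G) (P : Ideal R) : Ideal R where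
  carrier := {a | ∀ y ∈ L, biScale 𝒜 c y a ∈ P}
  zero_mem' y _ := by rw [map_zero]; exact P.zero_mem
  add_mem' ha hb y hy := by rw [map_add]; exact P.add_mem (ha y hy) (hb y hy)
  smul_mem' r a ha y hy := by
    rw [smul_eq_mul, biScale_mul]
    exact P.mul_mem_left _ (ha y hy)

variable {L : AddSubgroup G} {P : Ideal R}

theorem mem_biCore {a : R} : a ∈ biCore 𝒜 c L P ↔ ∀ y ∈ L, biScale 𝒜 c y a ∈ P := Iff.rfl

theorem biCore_le : biCore 𝒜 c L P ≤ P := fun a ha => by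
  simpa [biScale_zero] using ha 0 L.zero_mem

theorem isBiStable_biCore : IsBiStable 𝒜 c L ((biCore 𝒜 c L P).restrictScalars k) :=
  fun y hy s hs z hz => by
    rw [← biScale_add]
    exact hs _ (add_mem hz hy)

theorem mem_biCore_of_mem {x : G} {r : R} (hr : r ∈ 𝒜 x) (h : r ∈ P) : r ∈ biCore 𝒜 c L P :=
  fun y _ => biScale_mem_of_mem (S := P.restrictScalars k) y hr h

theorem InCoset.mem_biCore {h : G} {a : R} (ha : InCoset 𝒜 c L h a) (haP : a ∈ P) :
    a ∈ biCore 𝒜 c L P := fun y hy => by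
  rw [ha.biScale_eq hy]
  exact (P.restrictScalars k).smul_mem _ haP

theorem IsFullOutside.biCore (hP : IsFullOutside 𝒜 L (P.restrictScalars k)) :
    IsFullOutside 𝒜 L ((_root_.biCore 𝒜 c L P).restrictScalars k) :=
  fun x hx _ hr => mem_biCore_of_mem hr (hP x hx hr)

theorem Ideal.isMulIdeal (P : Ideal R) : IsMulIdeal (P.restrictScalars k) :=
  fun _ hs r => P.mul_mem_left r hs

theorem IsFullOutside.isTwistIdeal_biCore (hP : IsFullOutside 𝒜 L (P.restrictScalars k)) :
    IsTwistIdeal 𝒜 c ((_root_.biCore 𝒜 c L P).restrictScalars k) :=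
  (Ideal.isMulIdeal _).isTwistIdeal isBiStable_biCore hP.biCore

/-- Since `P` is prime, the degrees of homogeneous elements outside `P` form a submonoid, and the
group generated by a commutative submonoid consists of differences. -/
theorem exists_sub_of_mem_degGroup [P.IsPrime] {y : G} (hy : y ∈ degGroup 𝒜 (P.restrictScalars k)) :
    ∃ y₁ ∈ degSet 𝒜 (P.restrictScalars k), ∃ y₂ ∈ degSet 𝒜 (P.restrictScalars k),
      y = y₁ - y₂ := by
  have hadd : ∀ x ∈ degSet 𝒜 (P.restrictScalars k), ∀ y ∈ degSet 𝒜 (P.restrictScalars k),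
      x + y ∈ degSet 𝒜 (P.restrictScalars k) := by
    rintro x ⟨r, hr, hrP⟩ y ⟨s, hs, hsP⟩
    exact ⟨r * s, SetLike.mul_mem_graded hr hs,
      fun h => (Ideal.IsPrime.mem_or_mem ‹_› h).elim hrP hsP⟩
  have hzero : (0 : G) ∈ degSet 𝒜 (P.restrictScalars k) :=
    ⟨1, SetLike.one_mem_graded 𝒜, fun h => Ideal.IsPrime.ne_top ‹_› ((Ideal.eq_top_iff_one P).2 h)⟩
  induction hy using AddSubgroup.closure_induction with
  | mem x hx => exact ⟨x, hx, 0, hzero, (sub_zero x).symm⟩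
  | zero => exact ⟨0, hzero, 0, hzero, (sub_zero 0).symm⟩
  | add a b _ _ ha hb =>
    obtain ⟨y₁, h₁, y₂, h₂, rfl⟩ := ha
    obtain ⟨z₁, h₃, z₂, h₄, rfl⟩ := hb
    exact ⟨_, hadd _ h₁ _ h₃, _, hadd _ h₂ _ h₄, by abel⟩
  | neg a _ ha =>
    obtain ⟨y₁, h₁, y₂, h₂, rfl⟩ := ha
    exact ⟨_, h₂, _, h₁, by abel⟩

/-- For a prime ideal `P`, the core of `P` is the largest ideal of the twist contained in `P`. -/
theorem IsTwistIdeal.le_biCore [P.IsPrime] {S : Submodule k R} (hS : IsTwistIdeal 𝒜 c S)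
    (hSP : S ≤ P.restrictScalars k) :
    S ≤ (biCore 𝒜 c (degGroup 𝒜 (P.restrictScalars k)) P).restrictScalars k := by
  intro a ha y hy
  obtain ⟨y₁, ⟨r, hr, hrP⟩, y₂, ⟨s, hs, hsP⟩, rfl⟩ := exists_sub_of_mem_degGroup hy
  -- Multiplying by `r` on the left applies `c(y₁,-)` to `a`, and by `s` on the right `c(-y₂,-)`. Up
  -- to a nonzero scalar the result is `r · c(y₁ - y₂,-).a · s`, from which the prime `P` lets `r`
  -- and `s` be cancelled.
  have h : twistMul 𝒜 c (twistMul 𝒜 c r a) s ∈ P := hSP (hS _ (hS _ ha r).1 s).2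
  rw [twistMul_eq_mul_biScale 𝒜 c hr, twistMul_eq_biScale_neg_mul 𝒜 c _ hs, biScale_mul,
    ← biScale_add, neg_add_eq_sub] at h
  refine ((Ideal.IsPrime.mem_or_mem ‹_› ((Ideal.IsPrime.mem_or_mem ‹_› h).resolve_right
    hsP)).resolve_left ?_)
  exact fun h => hrP ((biScale_mem_iff_of_mem (S := P.restrictScalars k) hr).1 h)

theorem mem_biCore_of_mul_mem [P.IsPrime] {x : G} {r u : R} (hr : r ∈ 𝒜 x) (hrP : r ∉ P)
    (h : r * u ∈ biCore 𝒜 c L P) : u ∈ biCore 𝒜 c L P := by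
  intro y hy
  have h := h y hy
  rw [biScale_mul] at h
  exact (Ideal.IsPrime.mem_or_mem ‹_› h).resolve_left
    fun h => hrP ((biScale_mem_iff_of_mem (S := P.restrictScalars k) hr).1 h)

/-- Reduces a failing inclusion to a witness on a single coset, where the characters `c(y,-)`, `y ∈
L`, are scalars and the two products can be compared. -/
theorem exists_inCoset_notMem {S T : Submodule k R} (hst : IsBiStable 𝒜 c L S)
    (hf : IsFullOutside 𝒜 L S) (hT : IsFullOutside 𝒜 L T) (h : ¬ S ≤ T) :
    ∃ h ∈ L, ∃ a ∈ S, InCoset 𝒜 c L h a ∧ a ∉ T := by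
  contrapose! h
  exact hst.induction hf hT h

/-- The core of a prime ideal is a prime ideal of the twist. -/
theorem isTwistPrime_biCore
    (hc : (-1 : kˣ) ∉ Subgroup.closure (Set.range fun p : G × G => c p.1 p.2) ∨ CharP k 2)
    (hP : P.IsPrime) :
    IsTwistPrime 𝒜 c
      ((biCore 𝒜 c (degGroup 𝒜 (P.restrictScalars k)) P).restrictScalars k) where
  isTwistIdeal := (isFullOutside_degGroup _).isTwistIdeal_biCore
  one_notMem h := hP.ne_top ((Ideal.eq_top_iff_one P).2 (biCore_le h))
  mem_or_mem a b hab := by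
    set L := degGroup 𝒜 (P.restrictScalars k) with hL
    set K := (biCore 𝒜 c L P).restrictScalars k with hK
    have hKt : IsTwistIdeal 𝒜 c K := (isFullOutside_degGroup _).isTwistIdeal_biCore
    have hKf : IsFullOutside 𝒜 L K := (isFullOutside_degGroup _).biCore
    -- The elements `e` with `eAb ⊆ K` form an ideal of the twist containing `K` and `a`. It
    -- inherits stability from the general criterion because homogeneous elements outside `P` can be
    -- cancelled modulo `K`.
    let S : Submodule k R :=
      { carrier := {e | ∀ r, twistMul 𝒜 c e (twistMul 𝒜 c r b) ∈ K}
        zero_mem' := fun r => by simp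
        add_mem' := fun h h' r => by
          rw [map_add, LinearMap.add_apply]
          exact K.add_mem (h r) (h' r)
        smul_mem' := fun t e h r => by
          rw [map_smul, LinearMap.smul_apply]
          exact K.smul_mem t (h r) }
    have hSt : IsTwistIdeal 𝒜 c S := fun e he s =>
      ⟨fun r => by
        rw [CocycleTwist.twistMul_assoc]
        exact (hKt _ (he r) s).1,
      fun r => by
        rw [CocycleTwist.twistMul_assoc, ← CocycleTwist.twistMul_assoc 𝒜 c s]
        exact he _⟩
    have hKS : K ≤ S := fun e he r => (hKt e he _).2
    have hSf : IsFullOutside 𝒜 L S := hKf.mono hKS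
    have hSst : IsBiStable 𝒜 c L S := by
      refine hSt.isBiStable hc ?_
      rintro x ⟨r, hr, hrP⟩
      refine ⟨r, hr, fun u hu s => ?_⟩
      have h := hu s
      rw [CocycleTwist.twistMul_assoc, twistMul_eq_mul_biScale 𝒜 c hr] at h
      have h' := isBiStable_biCore (-x) (neg_mem (AddSubgroup.subset_closure (show x ∈ degSet 𝒜 _ from ⟨r, hr, hrP⟩))) _
        (mem_biCore_of_mul_mem hr hrP h)
      rwa [biScale_neg_biScale] at h'
    -- If `S` lies in `P`, it lies in the core by maximality, hence so does `a`. Otherwise some `e ∈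
    -- S` on one coset is outside `P`; the translates of `e · c(h,-).b` under `c(y - h,-)` only
    -- rescale `e`, so every `c(y,-).b` is in `P`.
    by_cases hle : S ≤ P.restrictScalars k
    · exact Or.inl (hSt.le_biCore hle hab)
    · right
      obtain ⟨h, hh, e, he, heco, heP⟩ :=
        exists_inCoset_notMem hSst hSf (isFullOutside_degGroup _) hle
      have h1 : e * biScale 𝒜 c h b ∈ K := by
        have h1 := heco.twistMul_sub_mul_mem (Ideal.isMulIdeal _) hKf b
        have h2 := he 1
        rw [CocycleTwist.twistMul_one_left] at h2
        exact (K.sub_mem_iff_right h2).1 h1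
      intro y hy
      have h2 := h1 (y - h) (sub_mem hy hh)
      rw [biScale_mul, ← biScale_add, sub_add_cancel, heco.biScale_eq (sub_mem hy hh),
        smul_mul_assoc] at h2
      have h3 := ((P.restrictScalars k).smul_mem_iff (c (y - h) h).ne_zero).1 h2
      exact (hP.mem_or_mem h3).resolve_left heP

/-- Homogeneous elements commute up to nonzero scalars, so `r'u' ∈ S'` already forces `r'Au' ⊆ S'`.
-/
theorem IsTwistPrime.mem_of_twistMul_mem {S : Submodule k R} (hS : IsTwistPrime 𝒜 c S) {x : G}
    {r u : R} (hr : r ∈ 𝒜 x) (hrS : r ∉ S) (h : twistMul 𝒜 c r u ∈ S) : u ∈ S := by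
  refine (hS.mem_or_mem r u fun s => ?_).resolve_left hrS
  induction s using DirectSum.Decomposition.inductionOn 𝒜 with
  | zero => simp
  | add a b ha hb =>
    rw [map_add, LinearMap.add_apply, map_add]
    exact S.add_mem ha hb
  | @homogeneous y s =>
    rw [← CocycleTwist.twistMul_assoc, twistMul_of_mem 𝒜 c hr s.2, mul_comm, map_smul,
      LinearMap.smul_apply]
    refine S.smul_mem _ ?_
    have h2 := (hS.isTwistIdeal _ h s).1
    rw [← CocycleTwist.twistMul_assoc, twistMul_of_mem 𝒜 c s.2 hr, map_smul,
      LinearMap.smul_apply] at h2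
    exact (S.smul_mem_iff (c y x).ne_zero).1 h2

theorem IsTwistPrime.mul_mem_iff {S : Submodule k R} (hS : IsTwistPrime 𝒜 c S) {x y : G}
    {r s : R} (hr : r ∈ 𝒜 x) (hs : s ∈ 𝒜 y) : r * s ∈ S ↔ r ∈ S ∨ s ∈ S := by
  refine ⟨fun h => ?_, ?_⟩
  · by_contra hn
    rw [not_or] at hn
    refine hn.2 (hS.mem_of_twistMul_mem hr hn.1 ?_)
    rw [twistMul_of_mem 𝒜 c hr hs]
    exact S.smul_mem _ h
  · rintro (h | h)
    · exact hS.isTwistIdeal.mul_mem_of_mem hr h s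
    · rw [mul_comm]
      exact hS.isTwistIdeal.mul_mem_of_mem hs h r

theorem IsTwistPrime.isBiStable
    (hc : (-1 : kˣ) ∉ Subgroup.closure (Set.range fun p : G × G => c p.1 p.2) ∨ CharP k 2)
    {S : Submodule k R} (hS : IsTwistPrime 𝒜 c S) : IsBiStable 𝒜 c (degGroup 𝒜 S) S :=
  hS.isTwistIdeal.isBiStable hc fun _ ⟨r, hr, hrS⟩ =>
    ⟨r, hr, fun _ hu => hS.mem_of_twistMul_mem hr hrS hu⟩

/-- Every prime ideal of the twist is the core of a prime ideal of `R`. -/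
theorem IsTwistPrime.exists_eq_biCore [IsNoetherianRing R]
    (hc : (-1 : kˣ) ∉ Subgroup.closure (Set.range fun p : G × G => c p.1 p.2) ∨ CharP k 2)
    {S : Submodule k R} (hS : IsTwistPrime 𝒜 c S) :
    ∃ P : Ideal R, P.IsPrime ∧
      S = (biCore 𝒜 c (degGroup 𝒜 (P.restrictScalars k)) P).restrictScalars k := by
  set L := degGroup 𝒜 S with hL
  have hst : IsBiStable 𝒜 c L S := hS.isBiStable hc
  have hf : IsFullOutside 𝒜 L S := isFullOutside_degGroup S
  have hmul : IsMulIdeal S := hS.isTwistIdeal.isMulIdeal hst hf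
  let I : Ideal R :=
    { carrier := S
      zero_mem' := S.zero_mem
      add_mem' := S.add_mem
      smul_mem' := fun r s hs => hmul s hs r }
  -- The group `L` is kept equal to that of `S` while `P` grows. A maximal such `P` is prime: if `ab
  -- ∈ P` with `a, b ∉ P`, the cores of `P + (a)` and `P + (b)` both leave `S`, yet their product
  -- falls into the core of `P`, against primeness of `S`.
  let Z : Set (Ideal R) := {P | I ≤ P ∧ biCore 𝒜 c L P ≤ I}
  obtain ⟨P, ⟨hIP, hPI⟩, hmax⟩ := set_has_maximal_iff_noetherian.2 (inferInstance : IsNoetherian R R)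
    Z ⟨I, le_rfl, biCore_le⟩
  have hprime : Ideal.IsPrime P := by
    refine ⟨fun h => hS.one_notMem ?_, fun {a b} hab => ?_⟩
    · refine hPI fun y _ => ?_
      rw [h]
      trivial
    · by_contra hn
      rw [not_or] at hn
      have key : ∀ a ∉ P, ¬ biCore 𝒜 c L (P ⊔ Ideal.span {a}) ≤ I := by
        intro a ha hle
        refine hmax (P ⊔ Ideal.span {a}) ⟨hIP.trans le_sup_left, hle⟩ ?_
        refine lt_of_le_of_ne le_sup_left fun he => ha ?_
        rw [he]
        exact Ideal.mem_sup_right (Ideal.mem_span_singleton_self a)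
      have hfull : ∀ a, IsFullOutside 𝒜 L ((P ⊔ Ideal.span {a}).restrictScalars k) := fun a =>
        hf.mono (T := (P ⊔ Ideal.span {a}).restrictScalars k) (hIP.trans le_sup_left)
      have hprod : (P ⊔ Ideal.span {a}) * (P ⊔ Ideal.span {b}) ≤ P := by
        rw [Ideal.sup_mul, Ideal.mul_sup, Ideal.mul_sup, Ideal.span_singleton_mul_span_singleton]
        exact sup_le (sup_le Ideal.mul_le_left Ideal.mul_le_left)
          (sup_le Ideal.mul_le_right ((Ideal.span_singleton_le_iff_mem P).2 hab))
      obtain ⟨h, hh, e, he, heco, heI⟩ := exists_inCoset_notMem isBiStable_biCore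
        (hfull a).biCore hf (T := S) (key a hn.1)
      obtain ⟨d, hd, hdI⟩ := SetLike.not_le_iff_exists.1 (key b hn.2)
      refine (hS.mem_or_mem e d fun r => ?_).elim heI hdI
      have hrd : twistMul 𝒜 c r d ∈ biCore 𝒜 c L (P ⊔ Ideal.span {b}) :=
        ((hfull b).isTwistIdeal_biCore d hd r).1
      have h1 := heco.twistMul_sub_mul_mem hmul hf (twistMul 𝒜 c r d)
      refine (S.sub_mem_iff_left ?_).1 h1
      refine hPI fun y hy => ?_
      rw [biScale_mul, ← biScale_add]
      exact hprod (Ideal.mul_mem_mul (he y hy) (hrd _ (add_mem hy hh)))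
  refine ⟨P, hprime, ?_⟩
  -- A homogeneous element of `P` is automatically in its core, so `P` and `S` have the same
  -- homogeneous elements and `L` is the group attached to `P` itself.
  have hset : degSet 𝒜 (P.restrictScalars k) = degSet 𝒜 S := by
    ext x
    refine exists_congr fun r => and_congr_right fun hr => not_congr ⟨fun h => ?_, fun h => hIP h⟩
    exact hPI (mem_biCore_of_mem hr h)
  rw [degGroup, hset]
  refine le_antisymm (fun s hs y hy => hIP (hst y hy s hs)) hPI

end Twist

/-! ### Monomials in homogeneous generators and the groups `G_w` -/

section Twist

open DirectSum

variable {k : Type u} {R : Type v} {G : Type w} [Field k] [CommRing R] [Algebra k R]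
  [AddCommGroup G] [DecidableEq G] {𝒜 : G → Submodule k R} [GradedAlgebra 𝒜]
  {c : AlternatingBicharacter G k}

/-- `S` is proper and behaves like a prime ideal on homogeneous elements. -/
structure IsGradedPrime (𝒜 : G → Submodule k R) (S : Submodule k R) : Prop where
  one_notMem : (1 : R) ∉ S
  mul_mem_iff : ∀ {x y : G} {r s : R}, r ∈ 𝒜 x → s ∈ 𝒜 y → (r * s ∈ S ↔ r ∈ S ∨ s ∈ S)

theorem IsTwistPrime.isGradedPrime {S : Submodule k R} (hS : IsTwistPrime 𝒜 c S) :
    IsGradedPrime 𝒜 S := ⟨hS.one_notMem, hS.mul_mem_iff⟩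

theorem Ideal.IsPrime.isGradedPrime {P : Ideal R} (hP : P.IsPrime) :
    IsGradedPrime 𝒜 (P.restrictScalars k) :=
  ⟨fun h => hP.ne_top ((Ideal.eq_top_iff_one P).2 h), fun _ _ => hP.mul_mem_iff_mem_or_mem⟩

namespace HomogeneousGenerators

variable {n : ℕ} (r : HomogeneousGenerators 𝒜 n)

/-- Monomials in the generators. -/
def mono (β : Fin n → ℕ) : R := ∏ i, r.gen i ^ β i

/-- Degrees of monomials in the generators. -/
def monoDeg (β : Fin n → ℕ) : G := ∑ i, β i • r.deg i

theorem mono_mem (β : Fin n → ℕ) : r.mono β ∈ 𝒜 (r.monoDeg β) :=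
  SetLike.prod_mem_graded 𝒜 _ _ fun i _ => SetLike.pow_mem_graded (β i) (r.gen_mem i)

theorem mono_add (β γ : Fin n → ℕ) : r.mono (β + γ) = r.mono β * r.mono γ := by
  simp only [mono, Pi.add_apply, pow_add, Finset.prod_mul_distrib]

theorem mono_zero : r.mono 0 = 1 := by simp [mono]

theorem span_range_mono : Submodule.span k (Set.range r.mono) = ⊤ := by
  rw [← top_le_iff, ← Algebra.top_toSubmodule, ← r.adjoin_eq_top, Algebra.adjoin_eq_span,
    Submodule.span_le]
  intro a ha
  apply Submodule.subset_span
  induction ha using Submonoid.closure_induction with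
  | mem a ha =>
    obtain ⟨i, rfl⟩ := ha
    refine ⟨Pi.single i 1, ?_⟩
    rw [mono, Finset.prod_eq_single i (fun j _ hj => by simp [hj]) (by simp)]
    simp
  | one => exact ⟨0, r.mono_zero⟩
  | mul a b _ _ ha hb =>
    obtain ⟨β, rfl⟩ := ha
    obtain ⟨γ, rfl⟩ := hb
    exact ⟨β + γ, r.mono_add β γ⟩

/-- Monomials are homogeneous and span `R`, so projecting onto degree `x` shows that those of degree
`x` span `𝒜 x`. -/
theorem exists_mono_notMem {S : Submodule k R} {x : G} {u : R} (hu : u ∈ 𝒜 x) (huS : u ∉ S) :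
    ∃ β, r.monoDeg β = x ∧ r.mono β ∉ S := by
  by_contra! hn
  refine huS ?_
  have key : ∀ a : R, (decompose 𝒜 a x : R) ∈ S := by
    intro a
    have ha : a ∈ Submodule.span k (Set.range r.mono) := by
      rw [r.span_range_mono]
      trivial
    induction ha using Submodule.span_induction with
    | mem a ha =>
      obtain ⟨β, rfl⟩ := ha
      rcases eq_or_ne (r.monoDeg β) x with rfl | h
      · rw [decompose_of_mem_same 𝒜 (r.mono_mem β)]
        exact hn β rfl
      · rw [decompose_of_mem_ne 𝒜 (r.mono_mem β) h]
        exact S.zero_mem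
    | zero => simp
    | add a b _ _ ha hb =>
      rw [decompose_add, DirectSum.add_apply, Submodule.coe_add]
      exact S.add_mem ha hb
    | smul t a _ ha =>
      rw [decompose_smul, DirectSum.smul_apply, Submodule.coe_smul]
      exact S.smul_mem t ha
  simpa [decompose_of_mem_same 𝒜 hu] using key u

theorem mono_mem_iff {S : Submodule k R} (hS : IsGradedPrime 𝒜 S) (β : Fin n → ℕ) :
    r.mono β ∈ S ↔ ∃ i, β i ≠ 0 ∧ r.gen i ∈ S := by
  have hpow : ∀ i m, r.gen i ^ m ∈ S ↔ m ≠ 0 ∧ r.gen i ∈ S := by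
    intro i m
    induction m with
    | zero => simpa using hS.one_notMem
    | succ m ih =>
      rw [pow_succ, hS.mul_mem_iff (SetLike.pow_mem_graded m (r.gen_mem i)) (r.gen_mem i), ih]
      simp
  have key : ∀ s : Finset (Fin n),
      ∏ i ∈ s, r.gen i ^ β i ∈ S ↔ ∃ i ∈ s, β i ≠ 0 ∧ r.gen i ∈ S := by
    intro s
    induction s using Finset.induction_on with
    | empty => simpa using hS.one_notMem
    | insert i s hi ih =>
      rw [Finset.prod_insert hi, hS.mul_mem_iff (SetLike.pow_mem_graded (β i) (r.gen_mem i))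
        (SetLike.prod_mem_graded 𝒜 _ _ fun j _ => SetLike.pow_mem_graded (β j) (r.gen_mem j)), ih,
        hpow]
      simp
  simpa [mono] using key Finset.univ

/-- A degree occurring outside `S` is that of a monomial outside `S`, which involves only generators
outside `S`. Thus the group depends on the stratum alone, for primes of `R` and of the twist alike.
-/
theorem degGroup_eq {S : Submodule k R} (hS : IsGradedPrime 𝒜 S) {W : Set (Fin n)}
    (hW : ∀ i, r.gen i ∈ S ↔ i ∈ W) : degGroup 𝒜 S = r.degreeSubgroup W := by
  refine le_antisymm ((AddSubgroup.closure_le _).2 ?_) (AddSubgroup.closure_mono ?_)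
  · rintro x ⟨u, hu, huS⟩
    obtain ⟨β, rfl, hβ⟩ := r.exists_mono_notMem hu huS
    rw [r.mono_mem_iff hS] at hβ
    push Not at hβ
    refine AddSubgroup.sum_mem _ fun i _ => ?_
    by_cases hi : β i = 0
    · rw [hi, zero_smul]
      exact zero_mem _
    · exact AddSubgroup.nsmul_mem _ (AddSubgroup.subset_closure
        (Set.mem_image_of_mem r.deg (show i ∈ Wᶜ from fun h => hβ i hi ((hW i).2 h)))) _
  · rintro _ ⟨i, hi, rfl⟩
    exact ⟨r.gen i, r.gen_mem i, fun h => hi ((hW i).1 h)⟩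

theorem mem_radPerp {W : Set (Fin n)} {h : AddChar G kˣ} :
    h ∈ r.radPerp W c ↔
      ∀ x ∈ r.degreeSubgroup W, x ∈ c.perp (r.degreeSubgroup W) → h x = 1 :=
  ⟨fun hh x hx hx' => hh x ⟨hx, hx'⟩, fun hh x hx => hh x hx.1 hx.2⟩

end HomogeneousGenerators

variable (𝒜) in
theorem exists_homogeneousGenerators [Algebra.FiniteType k R] :
    ∃ n, Nonempty (HomogeneousGenerators 𝒜 n) := by
  classical
  obtain ⟨s, hs⟩ := Algebra.FiniteType.out (R := k) (A := R)
  -- Components are stored together with their degree, since zero lies in every `𝒜 x` and an element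
  -- alone need not determine it.
  let T : Finset (G × R) := s.biUnion fun a =>
    (DFinsupp.support (decompose 𝒜 a)).image fun x => (x, (decompose 𝒜 a x : R))
  have hT : ∀ p ∈ T, p.2 ∈ 𝒜 p.1 := by
    intro p hp
    obtain ⟨a, -, ha⟩ := Finset.mem_biUnion.1 hp
    obtain ⟨x, -, rfl⟩ := Finset.mem_image.1 ha
    exact (decompose 𝒜 a x).2
  let e := T.equivFin.symm
  refine ⟨T.card, ⟨⟨fun i => (e i).1.2, fun i => (e i).1.1, fun i => hT _ (e i).2, ?_⟩⟩⟩
  rw [← top_le_iff, ← hs, Algebra.adjoin_le_iff]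
  intro a ha
  rw [← DirectSum.sum_support_decompose 𝒜 a]
  refine Subalgebra.sum_mem _ fun x hx => Algebra.subset_adjoin ?_
  have hp : (x, (decompose 𝒜 a x : R)) ∈ T :=
    Finset.mem_biUnion.2 ⟨a, ha, Finset.mem_image_of_mem _ hx⟩
  exact ⟨e.symm ⟨_, hp⟩, by simp⟩

/-! ### Cores, the action of `H`, and orbit intersections -/

variable (𝒜 c) in
/-- The largest ideal of the twist contained in a prime ideal `P`, as an ideal of `R`. -/
def primeCore (P : Ideal R) : Ideal R := biCore 𝒜 c (degGroup 𝒜 (P.restrictScalars k)) P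

theorem primeCore_le {P : Ideal R} : primeCore 𝒜 c P ≤ P := biCore_le

theorem isFullOutside_primeCore (P : Ideal R) : IsFullOutside 𝒜 (degGroup 𝒜 (P.restrictScalars k))
    ((primeCore 𝒜 c P).restrictScalars k) := (isFullOutside_degGroup _).biCore

theorem isBiStable_primeCore (P : Ideal R) : IsBiStable 𝒜 c (degGroup 𝒜 (P.restrictScalars k))
    ((primeCore 𝒜 c P).restrictScalars k) := isBiStable_biCore

theorem charAut_symm_apply (h : AddChar G kˣ) (a : R) :
    (charAut 𝒜 h).symm a = gradedScale 𝒜 (fun x => (h⁻¹ x : k)) a := rfl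

theorem gradedScale_comm (f g : G → k) (a : R) :
    gradedScale 𝒜 f (gradedScale 𝒜 g a) = gradedScale 𝒜 g (gradedScale 𝒜 f a) := by
  rw [← gradedScale_mul_apply, mul_comm, gradedScale_mul_apply]

theorem degGroup_comap_charAut (h : AddChar G kˣ) (P : Ideal R) :
    degGroup 𝒜 ((P.comap ((charAut 𝒜 h).symm : R →+* R)).restrictScalars k) =
      degGroup 𝒜 (P.restrictScalars k) := by
  have : degSet 𝒜 ((P.comap ((charAut 𝒜 h).symm : R →+* R)).restrictScalars k) =
      degSet 𝒜 (P.restrictScalars k) := by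
    ext x
    refine exists_congr fun r => and_congr_right fun hr => not_congr ?_
    change gradedScale 𝒜 (fun x => (h⁻¹ x : k)) r ∈ P ↔ r ∈ P
    rw [gradedScale_of_mem 𝒜 _ hr]
    exact (P.restrictScalars k).smul_mem_iff (Units.ne_zero _)
  rw [degGroup, this, degGroup]

/-- The source of equivariance: `H` is commutative and only rescales homogeneous elements, so it
changes neither the degree group nor the characters used to form the core. -/
theorem mem_primeCore_comap (h : AddChar G kˣ) (P : Ideal R) (a : R) :
    a ∈ primeCore 𝒜 c (P.comap ((charAut 𝒜 h).symm : R →+* R)) ↔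
      (charAut 𝒜 h).symm a ∈ primeCore 𝒜 c P := by
  rw [primeCore, degGroup_comap_charAut, primeCore, mem_biCore, mem_biCore]
  refine forall₂_congr fun y _ => ?_
  change gradedScale 𝒜 (fun x => (h⁻¹ x : k)) (biScale 𝒜 c y a) ∈ P ↔ _
  rw [biScale, gradedScale_comm, charAut_symm_apply]

/-- Stability under `c(y,-)`, `y ∈ L`, extends by interpolation to each character trivial on the
radical of `c` on `L`, since such a character is constant on the classes in `L` that the `c(y,-)`
fail to separate. -/
theorem gradedScale_mem_primeCore {P : Ideal R} {t : AddChar G kˣ}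
    (ht : ∀ x ∈ degGroup 𝒜 (P.restrictScalars k),
      x ∈ c.perp (degGroup 𝒜 (P.restrictScalars k)) → t x = 1)
    {a : R} (ha : a ∈ primeCore 𝒜 c P) :
    gradedScale 𝒜 (fun x => (t x : k)) a ∈ primeCore 𝒜 c P := by
  refine isBiStable_biCore.gradedScale_mem (S := (primeCore 𝒜 c P).restrictScalars k)
    (isFullOutside_degGroup _).biCore ?_ ha
  intro x hx x' hx' hxx
  have := ht _ (sub_mem hx hx') hxx
  rw [sub_eq_add_neg, AddChar.map_add_eq_mul, AddChar.map_neg_eq_inv, mul_inv_eq_one] at this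
  rw [this]

theorem AddChar.inv_inv_of_units (t : AddChar G kˣ) : t⁻¹⁻¹ = t := inv_inv t

theorem mem_orbitInf {P : Ideal R} {T : Subgroup (AddChar G kˣ)} {a : R} :
    a ∈ orbitInf 𝒜 P T ↔ ∀ t ∈ T, gradedScale 𝒜 (fun x => (t x : k)) a ∈ P := by
  have key : ∀ t : AddChar G kˣ, a ∈ P.map (charAut 𝒜 t : R →+* R) ↔
      gradedScale 𝒜 (fun x => (t⁻¹ x : k)) a ∈ P := by
    intro t
    rw [Ideal.mem_map_iff_of_surjective (charAut 𝒜 t : R →+* R) (charAut 𝒜 t).surjective]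
    constructor
    · rintro ⟨b, hb, rfl⟩
      change gradedScale 𝒜 _ (gradedScale 𝒜 _ b) ∈ P
      rwa [gradedScale_char_inv_left]
    · intro h
      exact ⟨_, h, gradedScale_char_inv_right 𝒜 t a⟩
  rw [orbitInf, Ideal.mem_iInf]
  constructor
  · intro h t ht
    have h' := (key t⁻¹).1 (h ⟨t⁻¹, inv_mem ht⟩)
    rwa [AddChar.inv_inv_of_units] at h'
  · intro h t
    exact (key _).2 (h _ (inv_mem t.2))

/-- The characters `c(y,-)`, `y ∈ G_w`, belong to `rad(c_w)^⊥`, which gives one inclusion; the other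
is the stability of the core under all of `rad(c_w)^⊥`. -/
theorem orbitInf_eq_primeCore {n : ℕ} (r : HomogeneousGenerators 𝒜 n) {W : Set (Fin n)}
    {P : Ideal R} (hP : P.IsPrime) (hW : ∀ i, r.gen i ∈ P ↔ i ∈ W) :
    orbitInf 𝒜 P (r.radPerp W c) = primeCore 𝒜 c P := by
  have hL := r.degGroup_eq (S := P.restrictScalars k) hP.isGradedPrime hW
  ext a
  rw [mem_orbitInf]
  constructor
  · intro h y hy
    refine h (c.char y) (r.mem_radPerp.2 fun x hx hx' => ?_)
    rw [hL] at hy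
    rw [c.char_apply, c.swap, hx' y hy, inv_one]
  · intro ha t ht
    refine primeCore_le (gradedScale_mem_primeCore ?_ ha)
    rw [hL]
    exact r.mem_radPerp.1 ht

/-! ### The quotient map from `spec R` to `spec A` -/

variable (𝒜) in
/-- The map `spec R → spec A`. -/
noncomputable def coreSpec
    (hc : (-1 : kˣ) ∉ Subgroup.closure (Set.range fun p : G × G => c p.1 p.2) ∨ CharP k 2)
    (P : PrimeSpectrum R) : PrimeIdealSpace (CocycleTwist 𝒜 c) :=
  ⟨_, (isTwistPrime_biCore hc P.isPrime).isPrimeIdeal⟩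

variable {hc : (-1 : kˣ) ∉ Subgroup.closure (Set.range fun p : G × G => c p.1 p.2) ∨ CharP k 2}

theorem mem_coreSpec {P : PrimeSpectrum R} {a : CocycleTwist 𝒜 c} :
    a ∈ (coreSpec 𝒜 hc P).asIdeal ↔
      (CocycleTwist.twist 𝒜 c).symm a ∈ primeCore 𝒜 c P.asIdeal :=
  IsTwistIdeal.mem_toTwoSidedIdeal (isTwistPrime_biCore hc P.isPrime).isTwistIdeal

theorem untwist_coreSpec {P : PrimeSpectrum R} :
    (coreSpec 𝒜 hc P).asIdeal.untwist = (primeCore 𝒜 c P.asIdeal).restrictScalars k :=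
  IsTwistIdeal.untwist_toTwoSidedIdeal (isTwistPrime_biCore hc P.isPrime).isTwistIdeal

theorem coe_coreSpec {P : PrimeSpectrum R} :
    ((coreSpec 𝒜 hc P).asIdeal : Set (CocycleTwist 𝒜 c)) =
      CocycleTwist.twist 𝒜 c '' (primeCore 𝒜 c P.asIdeal : Set R) := by
  ext a
  rw [SetLike.mem_coe, mem_coreSpec]
  exact ⟨fun h => ⟨_, h, rfl⟩, by rintro ⟨b, hb, rfl⟩; exact hb⟩

theorem coreSpec_surjective [IsNoetherianRing R] :
    Function.Surjective (coreSpec 𝒜 hc) := by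
  intro Q
  obtain ⟨P, hP, h⟩ := Q.isPrime.isTwistPrime.exists_eq_biCore hc
  refine ⟨⟨P, hP⟩, PrimeIdealSpace.ext (TwoSidedIdeal.untwist_injective ?_)⟩
  rw [h, untwist_coreSpec]
  rfl

theorem isGreatest_coreSpec (P : PrimeSpectrum R) :
    IsGreatest {I : TwoSidedIdeal (CocycleTwist 𝒜 c) |
      (I : Set (CocycleTwist 𝒜 c)) ⊆ CocycleTwist.twist 𝒜 c '' (P.asIdeal : Set R)}
      (coreSpec 𝒜 hc P).asIdeal := by
  have := P.isPrime
  constructor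
  · rw [Set.mem_ofPred_eq, coe_coreSpec]
    exact Set.image_mono primeCore_le
  · intro I hI a ha
    rw [mem_coreSpec]
    refine I.isTwistIdeal_untwist.le_biCore ?_ (x := (CocycleTwist.twist 𝒜 c).symm a) ha
    intro b hb
    obtain ⟨b', hb', h⟩ := hI hb
    obtain rfl := (CocycleTwist.twist 𝒜 c).injective h
    exact hb'

theorem coreSpec_charSpec (h : AddChar G kˣ) (P : PrimeSpectrum R) :
    coreSpec 𝒜 hc (charSpec 𝒜 h P) =
      (coreSpec 𝒜 hc P).act (charAutTwist 𝒜 c h).toRingEquiv := by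
  apply PrimeIdealSpace.ext
  ext a
  refine mem_coreSpec.trans ((mem_primeCore_comap h P.asIdeal _).trans ?_)
  change _ ↔ a ∈ RingEquiv.mapTwoSidedIdeal _ _
  rw [RingEquiv.mapTwoSidedIdeal_apply, TwoSidedIdeal.mem_comap, mem_coreSpec]
  rfl

theorem PrimeIdealSpace.isClosed_iff {A : Type u} [Ring A] {Z : Set (PrimeIdealSpace A)} :
    IsClosed Z ↔ ∃ S : Set A, Z = zeroLocus S := by
  rw [← isOpen_compl_iff]
  change Zᶜᶜ ∈ _ ↔ _
  rw [compl_compl]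
  rfl

theorem PrimitiveIdealSpace.isClosed_iff {A : Type u} [Ring A] {Z : Set (PrimitiveIdealSpace A)} :
    IsClosed Z ↔ ∃ S : Set A, Z = {P | S ⊆ (P.asIdeal : Set A)} := by
  rw [isClosed_induced_iff]
  constructor
  · rintro ⟨_, h, rfl⟩
    obtain ⟨S, rfl⟩ := PrimeIdealSpace.isClosed_iff.1 h
    exact ⟨S, rfl⟩
  · rintro ⟨S, rfl⟩
    exact ⟨_, PrimeIdealSpace.isClosed_iff.2 ⟨S, rfl⟩, rfl⟩

/-- A set of elements of the twist lies in the core of `P` if and only if the ideal it generates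
lies in `P`. -/
theorem subset_coreSpec_iff {P : PrimeSpectrum R} {S : Set (CocycleTwist 𝒜 c)} :
    S ⊆ ((coreSpec 𝒜 hc P).asIdeal : Set (CocycleTwist 𝒜 c)) ↔
      ((TwoSidedIdeal.span S).untwist : Set R) ⊆ P.asIdeal := by
  have := P.isPrime
  rw [← TwoSidedIdeal.span_le, ← TwoSidedIdeal.untwist_le_untwist, untwist_coreSpec]
  exact ⟨fun h _ ha => primeCore_le (h ha),
    fun h => (TwoSidedIdeal.isTwistIdeal_untwist _).le_biCore h⟩

/-- If `Z` is contained in `h(P)` for all `h ∈ H` such that `h(P)` and `P` have the same core,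
then `Z` is contained in this core. -/
theorem subset_primeCore {P : PrimeSpectrum R} {Z : Set R}
    (h : ∀ t : AddChar G kˣ, coreSpec 𝒜 hc (charSpec 𝒜 t P) = coreSpec 𝒜 hc P →
      Z ⊆ (charSpec 𝒜 t P).asIdeal) : Z ⊆ primeCore 𝒜 c P.asIdeal := by
  intro a ha y hy
  -- The character `c(-y,-)` preserves the core, so the corresponding conjugate of `P` has the same
  -- core; membership of `a` in this conjugate says that `c(y,-).a ∈ P`.
  have h1 := h (c.char (-y)) ?_ ha
  · have h2 : gradedScale 𝒜 (fun x => ((c.char (-y))⁻¹ x : k)) a ∈ P.asIdeal := h1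
    rwa [c.char_neg, AddChar.inv_inv_of_units] at h2
  · apply PrimeIdealSpace.ext
    ext b
    rw [mem_coreSpec, mem_coreSpec]
    refine (mem_primeCore_comap _ P.asIdeal _).trans ?_
    have hst : ∀ z ∈ degGroup 𝒜 (P.asIdeal.restrictScalars k), ∀ e ∈ primeCore 𝒜 c P.asIdeal,
        biScale 𝒜 c z e ∈ primeCore 𝒜 c P.asIdeal :=
      isBiStable_primeCore P.asIdeal
    rw [charAut_symm_apply, c.char_neg, AddChar.inv_inv_of_units]
    refine ⟨fun h => ?_, hst y hy _⟩
    have h' : biScale 𝒜 c (-y) (biScale 𝒜 c y ((CocycleTwist.twist 𝒜 c).symm b)) ∈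
      primeCore 𝒜 c P.asIdeal := hst (-y) (neg_mem hy) _ h
    rwa [biScale_neg_biScale] at h'

/-- If the preimage of `Y` is `V(Z)`, it is saturated: with `P` it contains every conjugate having
the same core. Hence `Z` lies in the core of `P`, and `Z'` defines `Y`. -/
theorem isQuotientMap_coreSpec [IsNoetherianRing R] :
    Topology.IsQuotientMap (coreSpec 𝒜 hc) := by
  rw [Topology.isQuotientMap_iff_isClosed]
  refine ⟨coreSpec_surjective, fun Y => ⟨fun hY => ?_, fun hY => ?_⟩⟩
  · obtain ⟨S, rfl⟩ := PrimeIdealSpace.isClosed_iff.1 hY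
    rw [PrimeSpectrum.isClosed_iff_zeroLocus]
    exact ⟨_, Set.ext fun P => subset_coreSpec_iff⟩
  · obtain ⟨Z, hZ⟩ := (PrimeSpectrum.isClosed_iff_zeroLocus _).1 hY
    have hmem : ∀ P : PrimeSpectrum R, coreSpec 𝒜 hc P ∈ Y ↔ Z ⊆ P.asIdeal := fun P =>
      Set.ext_iff.1 hZ P
    rw [PrimeIdealSpace.isClosed_iff]
    refine ⟨CocycleTwist.twist 𝒜 c '' Z, Set.ext fun Q => ?_⟩
    obtain ⟨P, rfl⟩ := coreSpec_surjective (hc := hc) Q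
    rw [PrimeIdealSpace.zeroLocus, Set.mem_ofPred_eq, coe_coreSpec,
      Set.image_subset_image_iff (CocycleTwist.twist 𝒜 c).injective]
    refine ⟨fun hP => subset_primeCore (hc := hc) fun t ht => ?_, fun hP => (hmem P).2 (hP.trans primeCore_le)⟩
    exact (hmem _).1 (ht ▸ hP)

end Twist

/-! ### Generic freeness -/

section GenericFreeness

/-- A form of generic freeness. If `V` is spanned over a domain `D` by vectors indexed by a
well-ordered monoid satisfying Dickson's lemma, on which the monoid acts by `D`-linear maps, and if
`V` is a vector space over the fraction field of `D`, then `V = 0`, unless the fraction field is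
obtained by inverting a single element of `D`. -/
theorem subsingleton_of_span_monoid {D V ι : Type*} [CommRing D] [IsDomain D] [AddCommGroup V]
    [Module D V] [AddCommMonoid ι] [LinearOrder ι] [WellFoundedLT ι] [IsOrderedCancelAddMonoid ι]
    (hdickson : ∀ S : Set ι, ∃ F : Finset ι, ↑F ⊆ S ∧ ∀ s ∈ S, ∃ f ∈ F, ∃ γ, s = γ + f)
    (e : ι → V) (hspan : Submodule.span D (Set.range e) = ⊤)
    (X : ι → V →ₗ[D] V) (hX : ∀ γ β, ∃ u : D, IsUnit u ∧ X γ (e β) = u • e (γ + β))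
    (hbij : ∀ d : D, d ≠ 0 → Function.Bijective fun v : V => d • v)
    (hD : ∀ f : D, f ≠ 0 → ∃ g, g ≠ 0 ∧ ∀ N : ℕ, ¬ g ∣ f ^ N) : Subsingleton V := by
  classical
  let lt : ι → Submodule D V := fun α => Submodule.span D (e '' Set.Iio α)
  let le : ι → Submodule D V := fun α => Submodule.span D (e '' Set.Iic α)
  have le_mono : ∀ {α β}, α ≤ β → le α ≤ le β := fun h =>
    Submodule.span_mono (Set.image_mono (Set.Iic_subset_Iic.2 h))
  have le_lt : ∀ {α β}, α < β → le α ≤ lt β := fun h =>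
    Submodule.span_mono (Set.image_mono fun x hx => lt_of_le_of_lt hx h)
  have lt_le : ∀ {α}, lt α ≤ le α := fun {_} =>
    Submodule.span_mono (Set.image_mono Set.Iio_subset_Iic_self)
  have e_le : ∀ {α}, e α ∈ le α := Submodule.subset_span ⟨_, le_rfl, rfl⟩
  have hzero : ∀ {d : D} {v : V}, d ≠ 0 → d • v = 0 → v = 0 := fun {d v} hd h =>
    (hbij d hd).1 (by simpa using h)
  have hspl : ∀ (I : Set ι) (v : V), v ∈ Submodule.span D (e '' I) →
      v = 0 ∨ ∃ β ∈ I, v ∈ le β := by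
    intro I v hv
    induction hv using Submodule.span_induction with
    | mem v hv =>
      obtain ⟨β, hβ, rfl⟩ := hv
      exact Or.inr ⟨β, hβ, e_le⟩
    | zero => exact Or.inl rfl
    | add v w _ _ hv hw =>
      rcases hv with rfl | ⟨β, hβ, hv⟩
      · rwa [zero_add]
      rcases hw with rfl | ⟨γ, hγ, hw⟩
      · rw [add_zero]
        exact Or.inr ⟨β, hβ, hv⟩
      rcases le_total β γ with h | h
      · exact Or.inr ⟨γ, hγ, add_mem (le_mono h hv) hw⟩
      · exact Or.inr ⟨β, hβ, add_mem hv (le_mono h hw)⟩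
    | smul d v _ hv =>
      rcases hv with rfl | ⟨β, hβ, hv⟩
      · exact Or.inl (smul_zero d)
      · exact Or.inr ⟨β, hβ, Submodule.smul_mem _ d hv⟩
  -- Translation by `γ` is strictly increasing, so `X γ` respects the filtration and carries torsion
  -- of the cyclic quotient `le α / lt α` to index `γ + α`.
  have hlead : ∀ (γ α) (d : D), d • e α ∈ lt α → d • e (γ + α) ∈ lt (γ + α) := by
    intro γ α d h
    have h1 : lt α ≤ (lt (γ + α)).comap (X γ) := by
      refine Submodule.span_le.2 ?_
      rintro _ ⟨β, hβ, rfl⟩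
      obtain ⟨u, -, hu⟩ := hX γ β
      rw [SetLike.mem_coe, Submodule.mem_comap, hu]
      exact Submodule.smul_mem _ _ (Submodule.subset_span ⟨_, add_lt_add_right hβ γ, rfl⟩)
    obtain ⟨u, hu, h2⟩ := hX γ α
    have h3 := h1 h
    rw [Submodule.mem_comap, map_smul, h2, smul_comm] at h3
    exact (Submodule.smul_mem_iff_of_isUnit _ hu).1 h3
  -- The indices whose quotient `le α / lt α` is torsion; elsewhere it is free of rank one.
  -- Dickson's lemma gives a single `f` killing all the torsion quotients.
  let S : Set ι := {α | ∃ d : D, d ≠ 0 ∧ d • e α ∈ lt α}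
  obtain ⟨F, hFS, hF⟩ := hdickson S
  choose! d hd0 hd using fun α (hα : α ∈ S) => hα
  let f : D := ∏ α ∈ F, d α
  have hf0 : f ≠ 0 := Finset.prod_ne_zero_iff.2 fun α hα => hd0 α (hFS hα)
  have hf : ∀ α ∈ S, f • e α ∈ lt α := by
    intro α hα
    obtain ⟨β, hβ, γ, rfl⟩ := hF α hα
    obtain ⟨q, hq⟩ := Finset.dvd_prod_of_mem d hβ
    rw [show f = q * d β by rw [mul_comm]; exact hq, mul_smul]
    exact Submodule.smul_mem _ _ (hlead γ β _ (hd β (hFS hβ)))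
  obtain ⟨g, hg0, hg⟩ := hD f hf0
  have hS : ∀ α ∉ S, ∀ a : D, a • e α ∈ lt α → a = 0 := fun α hα a ha => by
    by_contra h
    exact hα ⟨a, h, ha⟩
  by_cases hall : ∀ α, α ∈ S
  · have htor : ∀ α, ∃ N : ℕ, f ^ N • e α = 0 := by
      intro α
      induction α using WellFoundedLT.induction with
      | ind α ih =>
        have key : ∀ v ∈ lt α, ∃ N : ℕ, f ^ N • v = 0 := by
          intro v hv
          induction hv using Submodule.span_induction with
          | mem v hv =>
            obtain ⟨β, hβ, rfl⟩ := hv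
            exact ih β hβ
          | zero => exact ⟨0, smul_zero _⟩
          | add v w _ _ hv hw =>
            obtain ⟨N, hN⟩ := hv
            obtain ⟨N', hN'⟩ := hw
            refine ⟨N + N', ?_⟩
            rw [smul_add, pow_add, mul_smul _ _ w, hN', mul_comm, mul_smul, hN, smul_zero, smul_zero,
              add_zero]
          | smul a v _ hv =>
            obtain ⟨N, hN⟩ := hv
            exact ⟨N, by rw [smul_comm, hN, smul_zero]⟩
        obtain ⟨N, hN⟩ := key _ (hf α (hall α))
        exact ⟨N + 1, by rw [pow_succ, mul_smul, hN]⟩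
    have hbot : (⊤ : Submodule D V) ≤ ⊥ := by
      rw [← hspan, Submodule.span_le]
      rintro _ ⟨α, rfl⟩
      obtain ⟨N, hN⟩ := htor α
      exact hzero (pow_ne_zero N hf0) hN
    exact ⟨fun a b => (hbot (Submodule.mem_top (x := a))).trans
      (hbot (Submodule.mem_top (x := b))).symm⟩
  · push Not at hall
    obtain ⟨α, hα⟩ := hall
    exfalso
    -- At a free index `α`, divide `e α` by `g`, and let `β` be the least index bounding some `f ^ N
    -- • u`. Comparing leading terms in `f ^ N • e α = g • f ^ N • u` contradicts minimality of `β`,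
    -- freeness at `α`, or `g ∤ f ^ N`.
    obtain ⟨u, hu⟩ := (hbij g hg0).2 (e α)
    replace hu : g • u = e α := hu
    have hu0 : u ≠ 0 := by
      rintro rfl
      rw [smul_zero] at hu
      exact hα ⟨1, one_ne_zero, by rw [← hu, smul_zero]; exact zero_mem _⟩
    have hne : ∃ β, ∃ N : ℕ, f ^ N • u ∈ le β := by
      rcases hspl Set.univ u (by rw [Set.image_univ, hspan]; trivial) with h | ⟨β, -, h⟩
      · exact absurd h hu0
      · exact ⟨β, 0, by simpa using h⟩
    obtain ⟨β, ⟨N, hN⟩, hmin⟩ := WellFounded.has_min (wellFounded_lt (α := ι))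
      {β | ∃ N : ℕ, f ^ N • u ∈ le β} hne
    have hcontra : ∀ N : ℕ, f ^ N • u ∉ lt β := by
      intro N h
      rcases hspl _ _ h with h | ⟨γ, hγ, h⟩
      · exact hu0 (hzero (pow_ne_zero N hf0) h)
      · exact hmin γ ⟨N, h⟩ hγ
    have hins : f ^ N • u ∈ Submodule.span D (insert (e β) (e '' Set.Iio β)) := by
      rwa [← Set.image_insert_eq, Set.Iio_insert]
    obtain ⟨h, z, hz, hhz⟩ := Submodule.mem_span_insert.1 hins
    have hfN : f ^ N • e α = (g * h) • e β + g • z := by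
      rw [← hu, smul_comm, hhz, smul_add, mul_smul]
    by_cases hβ : β ∈ S
    · refine hcontra (N + 1) ?_
      rw [pow_succ', mul_smul, hhz, smul_add, smul_comm]
      exact add_mem (Submodule.smul_mem _ _ (hf β hβ)) (Submodule.smul_mem _ _ hz)
    · rcases lt_trichotomy α β with hlt | rfl | hlt
      · have h1 : (g * h) • e β ∈ lt β := by
          rw [← add_sub_cancel_right ((g * h) • e β) (g • z), ← hfN]
          exact sub_mem (Submodule.smul_mem _ _ (le_lt hlt e_le)) (Submodule.smul_mem _ _ hz)
        have h2 : h = 0 := (mul_eq_zero.1 (hS β hβ _ h1)).resolve_left hg0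
        rw [h2, zero_smul, zero_add] at hhz
        exact hcontra N (hhz ▸ hz)
      · have h1 : (f ^ N - g * h) • e α ∈ lt α := by
          rw [sub_smul, hfN, add_sub_cancel_left]
          exact Submodule.smul_mem _ _ hz
        exact hg N ⟨h, sub_eq_zero.1 (hS α hα _ h1)⟩
      · have h1 : f ^ N • e α ∈ lt α := by
          rw [hfN]
          exact add_mem (Submodule.smul_mem _ _ (le_lt hlt e_le))
            (Submodule.smul_mem _ _ (le_lt hlt (lt_le hz)))
        exact pow_ne_zero N hf0 (hS α hα _ h1)

/-- Dickson's lemma. -/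
theorem exists_finset_forall_exists_add {σ : Type*} [Finite σ] (S : Set (σ → ℕ)) :
    ∃ F : Finset (σ → ℕ), ↑F ⊆ S ∧ ∀ s ∈ S, ∃ f ∈ F, ∃ γ, s = γ + f := by
  have hfin : {x | Minimal (· ∈ S) x}.Finite :=
    WellQuasiOrderedLE.finite_of_isAntichain (setOfPred_minimal_antichain _)
  refine ⟨hfin.toFinset, fun x hx => (hfin.mem_toFinset.1 hx).prop, fun s hs => ?_⟩
  obtain ⟨f, hfs, hf⟩ := exists_minimal_le_of_wellFoundedLT (· ∈ S) s hs
  exact ⟨f, hfin.mem_toFinset.2 hf, s - f, (tsub_add_cancel_of_le hfs).symm⟩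

end GenericFreeness

/-! ### A Nullstellensatz for simple modules of the twist -/

section Twist

variable {k : Type u} {R : Type v} {G : Type w} [Field k] [CommRing R] [Algebra k R]
  [AddCommGroup G] [DecidableEq G] {𝒜 : G → Submodule k R} [GradedAlgebra 𝒜]
  {c : AlternatingBicharacter G k}

open Polynomial in
/-- Nullstellensatz for the twist: endomorphisms of simple modules are scalars. -/
theorem HomogeneousGenerators.exists_eq_smul [IsAlgClosed k] {n : ℕ}
    (r : HomogeneousGenerators 𝒜 n) {V : Type*} [AddCommGroup V] [Module (CocycleTwist 𝒜 c) V]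
    [IsSimpleModule (CocycleTwist 𝒜 c) V] (φ : V →ₗ[CocycleTwist 𝒜 c] V) :
    ∃ t : k, ∀ v : V, φ v = algebraMap k (CocycleTwist 𝒜 c) t • v := by
  classical
  let A := CocycleTwist 𝒜 c
  let _ : Module k V := Module.compHom V (algebraMap k A)
  have hkv : ∀ (t : k) (v : V), t • v = algebraMap k A t • v := fun _ _ => rfl
  have : IsScalarTower k A V := ⟨fun t a v => by rw [Algebra.smul_def, mul_smul, hkv]⟩
  have : SMulCommClass A k V := IsScalarTower.to_smulCommClass'
  have hint : Algebra.IsIntegral k (Module.End A V) := by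
    refine ⟨fun φ => ?_⟩
    rw [← isAlgebraic_iff_isIntegral]
    by_contra htr
    have hne : ∀ p : k[X], p ≠ 0 → aeval φ p ≠ 0 := fun p hp h => htr ⟨p, hp, h⟩
    -- If `φ` is transcendental, Schur's lemma makes each nonzero polynomial in `φ` bijective, so
    -- `V` is a vector space over the field of rational functions.
    let _ : Module k[X] V := Module.compHom V (aeval φ : k[X] →ₐ[k] Module.End A V).toRingHom
    have hpv : ∀ (p : k[X]) (v : V), p • v = aeval φ p v := fun _ _ => rfl
    have hnt := IsSimpleModule.nontrivial A V
    obtain ⟨v, hv⟩ := exists_ne (0 : V)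
    -- Twisted monomials multiply like monomials up to scalars in `kˣ`, so they act on these vectors
    -- by translation of exponents.
    let e : Lex (Fin n → ℕ) → V := fun β => CocycleTwist.twist 𝒜 c (r.mono (ofLex β)) • v
    have : Subsingleton V := by
      refine subsingleton_of_span_monoid (D := k[X]) (ι := Lex (Fin n → ℕ)) ?_ e ?_
        (fun γ => { toFun := fun w => (CocycleTwist.twist 𝒜 c (r.mono (ofLex γ)) : A) • w
                    map_add' := fun a b => smul_add _ _ _
                    map_smul' := fun p w => ((aeval φ p).map_smul _ _).symm }) ?_ ?_ ?_
      · exact fun S => exists_finset_forall_exists_add (σ := Fin n) S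
      · rw [← top_le_iff]
        intro w _
        have hw : w ∈ Submodule.span A {v} := by
          rw [IsSimpleModule.span_singleton_eq_top A hv]
          trivial
        obtain ⟨a, rfl⟩ := Submodule.mem_span_singleton.1 hw
        have ha : (CocycleTwist.twist 𝒜 c).symm a ∈ Submodule.span k (Set.range r.mono) := by
          rw [r.span_range_mono]
          trivial
        rw [← (CocycleTwist.twist 𝒜 c).apply_symm_apply a]
        generalize (CocycleTwist.twist 𝒜 c).symm a = b at ha
        induction ha using Submodule.span_induction with
        | mem b hb =>
          obtain ⟨β, rfl⟩ := hb
          exact Submodule.subset_span ⟨toLex β, rfl⟩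
        | zero => rw [map_zero, zero_smul]; exact zero_mem _
        | add b d _ _ hb hd => rw [map_add, add_smul]; exact add_mem hb hd
        | smul t b _ hb =>
          have h1 : (CocycleTwist.twist 𝒜 c (t • b) : A) • v =
              (C t : k[X]) • ((CocycleTwist.twist 𝒜 c b : A) • v) := by
            rw [map_smul, smul_assoc, hpv, aeval_C]
            rfl
          rw [h1]
          exact Submodule.smul_mem _ _ hb
      · intro γ β
        refine ⟨C (c (r.monoDeg (ofLex γ)) (r.monoDeg (ofLex β)) : k),
          Polynomial.isUnit_C.2 (Units.isUnit _), ?_⟩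
        change (CocycleTwist.twist 𝒜 c (r.mono (ofLex γ)) : A) •
          (CocycleTwist.twist 𝒜 c (r.mono (ofLex β)) : A) • v = _
        rw [← mul_smul, CocycleTwist.twist_mul_twist_of_mem 𝒜 c (r.mono_mem _) (r.mono_mem _),
          ← r.mono_add, smul_assoc, hpv, aeval_C]
        rfl
      · exact fun p hp => LinearMap.bijective_of_ne_zero (hne p hp)
      · intro f hf
        have : Infinite k := IsAlgClosed.instInfinite
        obtain ⟨t, ht⟩ : ∃ t, f.eval t ≠ 0 := by
          by_contra! h
          exact hf (Polynomial.funext fun t => by simpa using h t)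
        -- A linear factor at a point where `f` does not vanish divides no power of `f`.
        refine ⟨X - C t, X_sub_C_ne_zero t, fun N h => ?_⟩
        rw [dvd_iff_isRoot, IsRoot, eval_pow] at h
        exact pow_ne_zero N ht h
    exact hv (Subsingleton.elim _ _)
  obtain ⟨t, ht⟩ := (IsAlgClosed.algebraMap_bijective_of_isIntegral
    (k := k) (K := Module.End A V)).2 φ
  exact ⟨t, fun v => by rw [← ht]; rfl⟩

end Twist

/-! ### Cores of maximal ideals are primitive -/

section Twist

open DirectSum

variable {k : Type u} {R : Type v} {G : Type w} [Field k] [CommRing R] [Algebra k R]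
  [AddCommGroup G] [DecidableEq G] {𝒜 : G → Submodule k R} [GradedAlgebra 𝒜]
  {c : AlternatingBicharacter G k}

/-- By the Nullstellensatz `R ⧸ M` is finite over `k`, hence equal to `k`. -/
theorem exists_algHom_mem_iff [IsAlgClosed k] [Algebra.FiniteType k R] {M : Ideal R}
    (hM : M.IsMaximal) : ∃ m : R →ₐ[k] k, ∀ a, a ∈ M ↔ m a = 0 := by
  let _ : Field (R ⧸ M) := Ideal.Quotient.field M
  have : Module.Finite k (R ⧸ M) := finite_of_finite_type_of_isJacobsonRing k (R ⧸ M)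
  let e : k ≃ₐ[k] R ⧸ M := AlgEquiv.ofBijective (Algebra.ofId k (R ⧸ M))
    IsAlgClosed.algebraMap_bijective_of_isIntegral
  refine ⟨(e.symm : R ⧸ M →ₐ[k] k).comp (Ideal.Quotient.mkₐ k M), fun a => ?_⟩
  change a ∈ M ↔ e.symm (Ideal.Quotient.mk M a) = 0
  rw [map_eq_zero_iff _ e.symm.injective]
  exact Ideal.Quotient.eq_zero_iff_mem.symm

theorem exists_component_notMem {S : Submodule k R} {a : R} (ha : a ∉ S) :
    ∃ x, (decompose 𝒜 a x : R) ∉ S := by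
  classical
  by_contra! h
  refine ha ?_
  rw [← DirectSum.sum_support_decompose 𝒜 a]
  exact S.sum_mem fun x _ => h x

/-- A prime ideal of the twist contained in a maximal ideal `M` of `R` and containing the core of
`M` is the core, provided it contains no more generators. -/
theorem HomogeneousGenerators.le_of_primeCore_le
    (hc : (-1 : kˣ) ∉ Subgroup.closure (Set.range fun p : G × G => c p.1 p.2) ∨ CharP k 2)
    {n : ℕ} (r : HomogeneousGenerators 𝒜 n) {S : Submodule k R} (hS : IsTwistPrime 𝒜 c S)
    {M : Ideal R} (hM : M.IsPrime) (m : R →ₐ[k] k) (hm : ∀ a, a ∈ M ↔ m a = 0)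
    (hKS : (primeCore 𝒜 c M).restrictScalars k ≤ S) (hgen : ∀ i, r.gen i ∈ S → r.gen i ∈ M) :
    S ≤ (primeCore 𝒜 c M).restrictScalars k := by
  have hgen' : ∀ i, r.gen i ∈ S ↔ i ∈ {i | r.gen i ∈ M} := fun i =>
    ⟨hgen i, fun h => hKS (mem_biCore_of_mem (r.gen_mem i) h)⟩
  have hMg : IsGradedPrime 𝒜 (M.restrictScalars k) := hM.isGradedPrime
  have hL : degGroup 𝒜 S = degGroup 𝒜 (M.restrictScalars k) :=
    (r.degGroup_eq hS.isGradedPrime hgen').trans (r.degGroup_eq hMg fun i => Iff.rfl).symm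
  refine hS.isTwistIdeal.le_biCore ?_
  by_contra hle
  obtain ⟨h, hh, e, he, heco, heM⟩ := exists_inCoset_notMem (T := M.restrictScalars k)
    (hS.isBiStable hc) (isFullOutside_degGroup S) (hL ▸ isFullOutside_degGroup _) hle
  obtain ⟨x, hx⟩ := exists_component_notMem (𝒜 := 𝒜) heM
  have hxh : x - h ∈ c.perp (degGroup 𝒜 S) := heco x fun h0 => hx (by rw [h0]; exact zero_mem _)
  obtain ⟨γ, rfl, hγ⟩ := r.exists_mono_notMem (decompose 𝒜 e x).2 hx
  -- Both terms lie on the coset of `h`, and `m` kills the difference; an element of `M` on one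
  -- coset is in the core. As `e ∈ S` and `m e ≠ 0`, the monomial is forced into `S`.
  have hz : m e • r.mono γ - m (r.mono γ) • e ∈ primeCore 𝒜 c M := by
    rw [hL] at heco hxh
    refine (((InCoset.of_mem (r.mono_mem γ)).of_sub_mem hxh).smul _ |>.sub
      (heco.smul _)).mem_biCore ?_
    rw [hm, map_sub, map_smul, map_smul, smul_eq_mul, smul_eq_mul, mul_comm, sub_self]
  have h1 : m e • r.mono γ ∈ S := (S.sub_mem_iff_left (S.smul_mem _ he)).1 (hKS hz)
  have h2 : r.mono γ ∈ S := (S.smul_mem_iff fun h0 => heM ((hm e).2 h0)).1 h1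
  obtain ⟨i, hi, hiS⟩ := (r.mono_mem_iff hS.isGradedPrime γ).1 h2
  exact hγ ((r.mono_mem_iff hMg γ).2 ⟨i, hi, hgen i hiS⟩)

/-- The core of a maximal ideal is a primitive ideal of the twist. -/
theorem isPrimitiveIdeal_primeCore [IsAlgClosed k] [Algebra.FiniteType k R]
    (hc : (-1 : kˣ) ∉ Subgroup.closure (Set.range fun p : G × G => c p.1 p.2) ∨ CharP k 2)
    {M : Ideal R} (hM : M.IsMaximal) :
    (isTwistPrime_biCore (𝒜 := 𝒜) hc hM.isPrime).isTwistIdeal.toTwoSidedIdeal.IsPrimitiveIdeal := by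
  classical
  obtain ⟨n, ⟨r⟩⟩ := exists_homogeneousGenerators (k := k) 𝒜
  obtain ⟨m, hm⟩ := exists_algHom_mem_iff (k := k) hM
  set K := (primeCore 𝒜 c M).restrictScalars k with hK
  set L := degGroup 𝒜 (M.restrictScalars k) with hL
  have hKt : IsTwistIdeal 𝒜 c K := (isTwistPrime_biCore hc hM.isPrime).isTwistIdeal
  have hMg : IsGradedPrime 𝒜 (M.restrictScalars k) := hM.isPrime.isGradedPrime
  -- a homogeneous element `d` divisible by all generators outside `M`, with `m d = 1`
  let β : Fin n → ℕ := fun i => if r.gen i ∈ M then 0 else 1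
  have hβ : r.mono β ∉ M := by
    intro h
    obtain ⟨i, hi, hiM⟩ := (r.mono_mem_iff hMg β).1 h
    exact hi (if_pos hiM)
  have hmβ : m (r.mono β) ≠ 0 := fun h => hβ ((hm _).2 h)
  let d : R := (m (r.mono β))⁻¹ • r.mono β
  let x : G := r.monoDeg β
  have hd : d ∈ 𝒜 x := (𝒜 x).smul_mem _ (r.mono_mem β)
  have hmd : m d = 1 := by rw [map_smul, smul_eq_mul, inv_mul_cancel₀ hmβ]
  have hxL : x ∈ L := AddSubgroup.subset_closure ⟨_, r.mono_mem β, hβ⟩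
  -- a functional on the twist, invariant under right multiplication by `d`
  let B : AddSubgroup G := AddSubgroup.zmultiples x ⊔ c.perp L
  -- `B` contains `x`, so multiplying by `d` does not change membership of a degree in `B`, and
  -- `c(-,x)` is trivial on `B`, so no twisting scalar appears. It contains `c.perp L`, so
  -- projecting to `B` preserves the core and the functional vanishes there.
  let g : G → k := fun y => if y ∈ B then 1 else 0
  let f : R →ₗ[k] k := m.toLinearMap ∘ₗ gradedScale 𝒜 g
  have hgB : ∀ y y', y - y' ∈ B → g y = g y' := by
    intro y y' h
    have : y ∈ B ↔ y' ∈ B :=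
      ⟨fun hy => by simpa using sub_mem hy h, fun hy => by simpa using add_mem h hy⟩
    simp only [g, this]
  have hcB : ∀ y ∈ B, c y x = 1 := by
    intro y hy
    obtain ⟨y₁, h₁, y₂, h₂, rfl⟩ := AddSubgroup.mem_sup.1 hy
    obtain ⟨z, rfl⟩ := AddSubgroup.mem_zmultiples_iff.1 h₁
    have h3 : x ∈ AddMonoidHom.ker
        (AddMonoidHom.mk' (fun y => Additive.ofMul (c y x)) fun a b => c.add_left a b x) :=
      c.self x
    rw [c.add_left, c.mem_perp.1 h₂ x hxL, mul_one]
    exact AddSubgroup.zsmul_mem _ h3 z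
  have hf1 : f 1 = 1 := by
    change m (gradedScale 𝒜 g 1) = 1
    rw [gradedScale_of_mem 𝒜 g (SetLike.one_mem_graded 𝒜), map_smul, map_one]
    simp [g, B.zero_mem]
  have hfd : ∀ s, f (twistMul 𝒜 c s d) = f s := by
    intro s
    induction s using DirectSum.Decomposition.inductionOn 𝒜 with
    | zero => simp
    | add a b ha hb => rw [map_add, LinearMap.add_apply, map_add, ha, hb, map_add]
    | @homogeneous y a =>
      rw [twistMul_of_mem 𝒜 c a.2 hd, map_smul]
      change (c y x : k) • m (gradedScale 𝒜 g (a * d)) = m (gradedScale 𝒜 g a)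
      rw [gradedScale_of_mem 𝒜 g (SetLike.mul_mem_graded a.2 hd), gradedScale_of_mem 𝒜 g a.2,
        map_smul, map_smul, map_mul, hmd, mul_one, hgB (y + x) y
          (by rw [add_sub_cancel_left]
              exact AddSubgroup.mem_sup_left (AddSubgroup.mem_zmultiples x))]
      by_cases hy : y ∈ B
      · rw [hcB y hy, Units.val_one, one_smul]
      · simp [g, hy]
  have hfK : ∀ s ∈ K, f s = 0 := by
    intro s hs
    refine (hm _).1 (primeCore_le (c := c) (𝒜 := 𝒜) ?_)
    exact (isBiStable_primeCore M).gradedScale_mem (isFullOutside_primeCore M)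
      (fun y _ y' _ h => hgB y y' (AddSubgroup.mem_sup_right h)) hs
  let A := CocycleTwist 𝒜 c
  let tw : R ≃ₗ[k] A := CocycleTwist.twist 𝒜 c
  -- The largest left ideal in the kernel of the functional. It is proper and contains both the core
  -- and `1 - d`.
  let J : Ideal A :=
    { carrier := {a | ∀ s, f (twistMul 𝒜 c s (tw.symm a)) = 0}
      zero_mem' := fun s => by simp
      add_mem' := fun ha hb s => by rw [map_add, map_add, map_add, ha s, hb s, add_zero]
      smul_mem' := fun b a ha s => by
        change f (twistMul 𝒜 c s (twistMul 𝒜 c (tw.symm b) (tw.symm a))) = 0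
        rw [← CocycleTwist.twistMul_assoc]
        exact ha _ }
  have hJ : J ≠ ⊤ := fun h => by
    have h1 : (1 : A) ∈ J := by rw [h]; trivial
    have h2 : f (twistMul 𝒜 c 1 1) = 0 := h1 1
    rw [CocycleTwist.twistMul_one_left, hf1] at h2
    exact one_ne_zero h2
  obtain ⟨J', hJ', hJJ'⟩ := Ideal.exists_le_maximal J hJ
  have hsimple : IsSimpleModule A (A ⧸ J') := isSimpleModule_iff_isCoatom.2 hJ'.out
  let I : TwoSidedIdeal A := TwoSidedIdeal.ker (Module.toAddMonoidEnd A (A ⧸ J'))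
  have hI : ∀ a : A, a ∈ I ↔ ∀ v : A ⧸ J', a • v = 0 := fun a => by
    rw [TwoSidedIdeal.mem_ker]
    exact AddMonoidHom.ext_iff
  have hIprim : I.IsPrimitiveIdeal := ⟨A ⧸ J', _, _, hsimple, hI⟩
  have hS := hIprim.isPrimeIdeal.isTwistPrime
  have hKI : K ≤ I.untwist := by
    intro a ha
    rw [TwoSidedIdeal.mem_untwist, hI]
    intro v
    obtain ⟨b, rfl⟩ := Submodule.Quotient.mk_surjective J' v
    rw [← Submodule.Quotient.mk_smul, Submodule.Quotient.mk_eq_zero]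
    exact hJJ' fun s => hfK _ (hKt _ (hKt a ha _).2 s).1
  -- Since `1 - d ∈ J'`, having `d` in the annihilator of `A ⧸ J'` would give `1 ∈ J'`. Hence no
  -- generator outside `M` lies in `I`.
  have hdI : r.mono β ∉ I.untwist := by
    intro h
    have h1 : d ∈ I.untwist := Submodule.smul_mem _ _ h
    rw [TwoSidedIdeal.mem_untwist, hI] at h1
    have h2 := h1 (Submodule.Quotient.mk 1)
    rw [← Submodule.Quotient.mk_smul, Submodule.Quotient.mk_eq_zero, smul_eq_mul, mul_one] at h2
    refine hJ'.ne_top ((Ideal.eq_top_iff_one J').2 ?_)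
    rw [← sub_add_cancel (1 : A) (CocycleTwist.twist 𝒜 c d)]
    refine J'.add_mem (hJJ' fun s => ?_) h2
    change f (twistMul 𝒜 c s (1 - d)) = 0
    rw [map_sub, map_sub, hfd, CocycleTwist.twistMul_one_right, sub_self]
  have hle : I.untwist ≤ K := by
    refine r.le_of_primeCore_le hc hS hM.isPrime m hm hKI fun i hi => ?_
    by_contra hiM
    exact hdI ((r.mono_mem_iff hS.isGradedPrime β).2 ⟨i, by simp [β, hiM], hi⟩)
  have hEq : hKt.toTwoSidedIdeal = I :=
    TwoSidedIdeal.untwist_injective (hKt.untwist_toTwoSidedIdeal.trans (le_antisymm hKI hle))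
  exact hEq ▸ hIprim

/-- Modulo `S`, an element on the coset of `x` is normal with the same automorphism `c(2x,-)` as a
homogeneous element of degree `x`. On modules killed by `S`, the ratio of two such elements
therefore commutes with the action. -/
theorem InCoset.twistMul_sub_twistMul_mem {L : AddSubgroup G} {S : Submodule k R}
    (hS : IsTwistIdeal 𝒜 c S) (hf : IsFullOutside 𝒜 L S) {x : G} {e : R}
    (he : InCoset 𝒜 c L x e) (a : R) :
    twistMul 𝒜 c e a - twistMul 𝒜 c (biScale 𝒜 c (x + x) a) e ∈ S := by
  induction a using DirectSum.Decomposition.inductionOn 𝒜 with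
  | zero => simp
  | add a b ha hb =>
    rw [map_add, map_add, map_add, LinearMap.add_apply, add_sub_add_comm]
    exact S.add_mem ha hb
  | @homogeneous y a =>
    rw [biScale_of_mem 𝒜 c _ a.2, map_smul, LinearMap.smul_apply]
    by_cases hy : y ∈ L
    · have hs : c (x + x) y * c y x = c (-y) x := by
        rw [c.add_left, c.neg_left, c.swap y x, inv_inv, mul_inv_cancel_right]
      rw [twistMul_eq_biScale_neg_mul 𝒜 c e a.2, twistMul_eq_mul_biScale 𝒜 c a.2,
        he.biScale_eq hy, he.biScale_eq (neg_mem hy), smul_mul_assoc, mul_smul_comm, smul_smul,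
        mul_comm e, ← Units.val_mul, hs, sub_self]
      exact S.zero_mem
    · exact S.sub_mem (hS _ (hf y hy a.2) _).1 (S.smul_mem _ (hS _ (hf y hy a.2) _).2)

end Twist

/-! ### Primitive ideals as cores, and conjugacy of maximal ideals -/

section Twist

open DirectSum

variable {k : Type u} {R : Type v} {G : Type w} [Field k] [CommRing R] [Algebra k R]
  [AddCommGroup G] [DecidableEq G] {𝒜 : G → Submodule k R} [GradedAlgebra 𝒜]
  {c : AlternatingBicharacter G k}

/-- A homogeneous element acts bijectively on a simple module of the twist which it does not
annihilate. -/
theorem bijective_smul_of_mem {V : Type*} [AddCommGroup V] [Module (CocycleTwist 𝒜 c) V]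
    [IsSimpleModule (CocycleTwist 𝒜 c) V] {x : G} {u : R} (hu : u ∈ 𝒜 x)
    (h : ∃ v : V, CocycleTwist.twist 𝒜 c u • v ≠ 0) :
    Function.Bijective fun v : V => CocycleTwist.twist 𝒜 c u • v := by
  let A := CocycleTwist 𝒜 c
  let tw : R ≃ₗ[k] A := CocycleTwist.twist 𝒜 c
  have hcomm : ∀ a, tw a * tw u = tw u * tw (biScale 𝒜 c (-(x + x)) a) := fun a =>
    congrArg tw (twistMul_comm_of_mem 𝒜 c hu a)
  have hcomm' : ∀ a, tw u * tw a = tw (biScale 𝒜 c (x + x) a) * tw u := fun a => by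
    rw [hcomm, biScale_neg_biScale]
  -- Normality of `u` makes the kernel and the image of its action submodules.
  let K : Submodule A V :=
    { carrier := {v | tw u • v = 0}
      zero_mem' := smul_zero _
      add_mem' := fun {a b} ha hb => by
        change tw u • (a + b) = 0
        rw [smul_add, show tw u • a = 0 from ha, show tw u • b = 0 from hb, add_zero]
      smul_mem' := fun a v hv => by
        change tw u • a • v = 0
        rw [← mul_smul, ← tw.apply_symm_apply a, hcomm', mul_smul, show tw u • v = 0 from hv,
          smul_zero] }
  let I : Submodule A V :=
    { carrier := Set.range fun v => tw u • v
      zero_mem' := ⟨0, smul_zero _⟩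
      add_mem' := by
        rintro _ _ ⟨a, rfl⟩ ⟨b, rfl⟩
        exact ⟨a + b, smul_add _ _ _⟩
      smul_mem' := by
        rintro a _ ⟨v, rfl⟩
        refine ⟨tw (biScale 𝒜 c (-(x + x)) (tw.symm a)) • v, ?_⟩
        change tw u • tw _ • v = a • tw u • v
        rw [← mul_smul, ← hcomm, tw.apply_symm_apply, mul_smul] }
  obtain ⟨v, hv⟩ := h
  have hK : K = ⊥ := (eq_bot_or_eq_top K).resolve_right fun ht => hv (by
    have : v ∈ K := by rw [ht]; trivial
    exact this)
  have hI : I = ⊤ := (eq_bot_or_eq_top I).resolve_left fun hb => hv (by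
    have : tw u • v ∈ I := ⟨v, rfl⟩
    rw [hb] at this
    exact this)
  refine ⟨fun a b hab => ?_, fun w => ?_⟩
  · have h1 : a - b ∈ K := by
      change tw u • (a - b) = 0
      rw [smul_sub]
      exact sub_eq_zero.2 hab
    rw [hK] at h1
    exact sub_eq_zero.1 h1
  · have : w ∈ I := by rw [hI]; trivial
    exact this

/-- Every primitive ideal of the twist is the core of a maximal ideal of `R`. -/
theorem TwoSidedIdeal.IsPrimitiveIdeal.exists_eq_primeCore [IsAlgClosed k] [Algebra.FiniteType k R]
    (hc : (-1 : kˣ) ∉ Subgroup.closure (Set.range fun p : G × G => c p.1 p.2) ∨ CharP k 2)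
    {I : TwoSidedIdeal (CocycleTwist 𝒜 c)} (hI : I.IsPrimitiveIdeal) :
    ∃ M : Ideal R, M.IsMaximal ∧ I.untwist = (primeCore 𝒜 c M).restrictScalars k := by
  classical
  have hnoeth : IsNoetherianRing R := Algebra.FiniteType.isNoetherianRing k R
  have hjac : IsJacobsonRing R := isJacobsonRing_of_finiteType (A := k)
  obtain ⟨n, ⟨r⟩⟩ := exists_homogeneousGenerators (k := k) 𝒜
  have hS := hI.isPrimeIdeal.isTwistPrime
  obtain ⟨P, hP, hSP⟩ := hS.exists_eq_biCore hc
  obtain ⟨V, _, _, hV, hann⟩ := hI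
  have hann' : ∀ a : R, a ∈ I.untwist ↔ ∀ v : V, CocycleTwist.twist 𝒜 c a • v = 0 := fun a =>
    hann _
  set S := I.untwist with hSdef
  have hSleP : ∀ a ∈ S, a ∈ P := fun a ha => by
    rw [hSP] at ha
    exact biCore_le ha
  have hgenP : ∀ i, r.gen i ∈ P ↔ r.gen i ∈ S := fun i =>
    ⟨fun h => by rw [hSP]; exact mem_biCore_of_mem (r.gen_mem i) h, hSleP _⟩
  have hPg : IsGradedPrime 𝒜 (P.restrictScalars k) := hP.isGradedPrime
  let β : Fin n → ℕ := fun i => if r.gen i ∈ S then 0 else 1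
  have hβ : r.mono β ∉ P := by
    intro h
    obtain ⟨i, hi, hiP⟩ := (r.mono_mem_iff hPg β).1 h
    exact hi (if_pos ((hgenP i).1 hiP))
  -- As `R` is Jacobson, `P` is an intersection of maximal ideals. Avoiding the product of all
  -- generators outside `S` keeps `M` in the stratum of `S`.
  obtain ⟨M, hPM, hM, hβM⟩ : ∃ M : Ideal R, P ≤ M ∧ M.IsMaximal ∧ r.mono β ∉ M := by
    by_contra! h
    refine hβ ?_
    rw [← hjac.out hP.isRadical]
    exact Ideal.mem_sInf.2 fun {M} hM => h M hM.1 hM.2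
  have hMg : IsGradedPrime 𝒜 (M.restrictScalars k) := hM.isPrime.isGradedPrime
  have hgenM : ∀ i, r.gen i ∈ M ↔ r.gen i ∈ S := fun i => by
    refine ⟨fun h => ?_, fun h => hPM (hSleP _ h)⟩
    by_contra hi
    exact hβM ((r.mono_mem_iff hMg β).2 ⟨i, by simp [β, hi], h⟩)
  have hL : degGroup 𝒜 S = degGroup 𝒜 (M.restrictScalars k) :=
    (r.degGroup_eq (W := {i | r.gen i ∈ S}) hS.isGradedPrime fun i => Iff.rfl).trans
      (r.degGroup_eq hMg hgenM).symm
  have hmono : ∀ γ, r.mono γ ∈ M → r.mono γ ∈ S := fun γ h => by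
    obtain ⟨i, hi, hiM⟩ := (r.mono_mem_iff hMg γ).1 h
    exact (r.mono_mem_iff hS.isGradedPrime γ).2 ⟨i, hi, (hgenM i).1 hiM⟩
  have := hM.isPrime
  have hSK : S ≤ (primeCore 𝒜 c M).restrictScalars k :=
    hS.isTwistIdeal.le_biCore fun a ha => hPM (hSleP a ha)
  refine ⟨M, hM, le_antisymm hSK ?_⟩
  by_contra hle
  obtain ⟨h, hh, e, he, heco, heS⟩ := exists_inCoset_notMem (T := S) (isBiStable_primeCore M)
    (isFullOutside_primeCore M) (hL ▸ isFullOutside_degGroup S) hle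
  rw [← hL] at hh heco
  obtain ⟨x, hx⟩ := exists_component_notMem (𝒜 := 𝒜) heS
  have hxh : x - h ∈ c.perp (degGroup 𝒜 S) := heco x fun h0 => hx (by rw [h0]; exact S.zero_mem)
  obtain ⟨γ, rfl, hγ⟩ := r.exists_mono_notMem (decompose 𝒜 e x).2 hx
  set x := r.monoDeg γ with hxdef
  set u := r.mono γ with hudef
  have hu : u ∈ 𝒜 x := r.mono_mem γ
  have heco' : InCoset 𝒜 c (degGroup 𝒜 S) x e := heco.of_sub_mem (by
    rw [← neg_sub, neg_mem_iff]
    exact hxh)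
  have hbij : Function.Bijective fun v : V => CocycleTwist.twist 𝒜 c u • v :=
    bijective_smul_of_mem hu (by
      by_contra! hn
      exact hγ ((hann' u).2 hn))
  have hcomm : ∀ {e : R}, InCoset 𝒜 c (degGroup 𝒜 S) x e → ∀ (a : R) (v : V),
      CocycleTwist.twist 𝒜 c e • CocycleTwist.twist 𝒜 c a • v =
        CocycleTwist.twist 𝒜 c (biScale 𝒜 c (x + x) a) • CocycleTwist.twist 𝒜 c e • v := by
    intro e he a v
    have h1 := (hann' _).1
      (he.twistMul_sub_twistMul_mem hS.isTwistIdeal (isFullOutside_degGroup S) a) v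
    rw [map_sub, sub_smul, sub_eq_zero, ← CocycleTwist.twist_mul_twist,
      ← CocycleTwist.twist_mul_twist, mul_smul, mul_smul] at h1
    exact h1
  let E : V ≃ V := Equiv.ofBijective _ hbij
  have hE : ∀ v, CocycleTwist.twist 𝒜 c u • E.symm v = v := E.apply_symm_apply
  -- The operator `u⁻¹e` is linear, because `e` and `u` pass an element of the twist through the
  -- same automorphism.
  let φ : V →ₗ[CocycleTwist 𝒜 c] V :=
    { toFun := fun v => E.symm (CocycleTwist.twist 𝒜 c e • v)
      map_add' := fun v w => hbij.1 (by
        change CocycleTwist.twist 𝒜 c u • _ = CocycleTwist.twist 𝒜 c u • _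
        rw [hE, smul_add (CocycleTwist.twist 𝒜 c u), hE, hE, smul_add])
      map_smul' := fun a v => hbij.1 (by
        change CocycleTwist.twist 𝒜 c u • _ =
          CocycleTwist.twist 𝒜 c u • CocycleTwist.twist 𝒜 c ((CocycleTwist.twist 𝒜 c).symm a) • _
        rw [hE, hcomm (InCoset.of_mem hu), hE, ← hcomm heco', LinearEquiv.apply_symm_apply]) }
  obtain ⟨t, ht⟩ := r.exists_eq_smul φ
  have h1 : e - t • u ∈ S := by
    rw [hann']
    intro v
    have h2 : CocycleTwist.twist 𝒜 c e • v =
        CocycleTwist.twist 𝒜 c u • algebraMap k (CocycleTwist 𝒜 c) t • v := by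
      rw [← ht]
      exact (hE _).symm
    rw [map_sub, map_smul, sub_smul, h2, Algebra.smul_def, Algebra.commutes, mul_smul, sub_self]
  -- `e - t • u` annihilates `V`, so it lies in `S`, hence in the core, as `e` does. Since `u ∉ M`,
  -- this forces `t = 0` and `e ∈ S`.
  have h2 : t • u ∈ M := by
    have h3 : t • u ∈ primeCore 𝒜 c M := (((primeCore 𝒜 c M).restrictScalars k).sub_mem_iff_right
      he).1 (hSK h1)
    exact primeCore_le h3
  have h3 : t = 0 := by
    by_contra h0
    exact hγ (hmono γ (((M.restrictScalars k).smul_mem_iff h0).1 h2))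
  rw [h3, zero_smul, sub_zero] at h1
  exact heS h1

/-- Roots exist in `k`, so `kˣ` is divisible, and homomorphisms from subgroups to it extend. -/
theorem baer_additive_units [IsAlgClosed k] : Module.Baer ℤ (Additive kˣ) := by
  have : RootableBy kˣ ℕ := rootableByOfPowLeftSurj kˣ ℕ fun {n} hn u => by
    obtain ⟨z, hz⟩ := IsAlgClosed.exists_pow_nat_eq (u : k) (Nat.pos_of_ne_zero hn)
    have hz0 : z ≠ 0 := by
      rintro rfl
      rw [zero_pow hn] at hz
      exact u.ne_zero hz.symm
    exact ⟨Units.mk0 z hz0, Units.ext hz⟩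
  have : RootableBy kˣ ℤ := Group.rootableByIntOfRootableByNat kˣ
  have : DivisibleBy (Additive kˣ) ℤ :=
    { div := fun a n => Additive.ofMul (RootableBy.root a.toMul n)
      div_zero := fun a => congrArg Additive.ofMul (RootableBy.root_zero a.toMul)
      div_cancel := fun {n} a hn => congrArg Additive.ofMul (RootableBy.root_cancel a.toMul hn) }
  exact Module.Baer.of_divisible _

/-- A homomorphism to `kˣ` factors through a homomorphism `F` if it is trivial on its kernel. -/
theorem exists_hom_comp_eq [IsAlgClosed k] {X Y : Type*} [AddCommGroup X] [AddCommGroup Y]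
    (F : X →+ Y) (τ : X →+ Additive kˣ) (h : F.ker ≤ τ.ker) :
    ∃ T : Y →+ Additive kˣ, ∀ x, T (F x) = τ x := by
  obtain ⟨T, hT⟩ := baer_additive_units.extension_property_addMonoidHom
    (QuotientAddGroup.kerLift F) (QuotientAddGroup.kerLift_injective F)
    (QuotientAddGroup.lift F.ker τ h)
  exact ⟨T, fun x => DFunLike.congr_fun hT (x : X ⧸ F.ker)⟩

/-- Maximal ideals with the same core are conjugate. -/
theorem HomogeneousGenerators.exists_charMax_eq [IsAlgClosed k] [Algebra.FiniteType k R]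
    {n : ℕ} (r : HomogeneousGenerators 𝒜 n) {W : Set (Fin n)} {M N : MaximalSpectrum R}
    (hM : M ∈ r.maxStratum W) (hMN : primeCore 𝒜 c M.asIdeal = primeCore 𝒜 c N.asIdeal) :
    ∃ t ∈ r.radPerp W c, N = charMax 𝒜 t M := by
  classical
  obtain ⟨m, hm⟩ := exists_algHom_mem_iff (k := k) M.isMaximal
  obtain ⟨l, hl⟩ := exists_algHom_mem_iff (k := k) N.isMaximal
  have hN : N ∈ r.maxStratum W := fun i => by
    refine Iff.trans ⟨fun h => ?_, fun h => ?_⟩ (hM i)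
    · exact primeCore_le (hMN ▸ mem_biCore_of_mem (r.gen_mem i) h : _ ∈ primeCore 𝒜 c M.asIdeal)
    · exact primeCore_le (hMN ▸ mem_biCore_of_mem (r.gen_mem i) h : _ ∈ primeCore 𝒜 c N.asIdeal)
  have hm0 : ∀ i, m (r.gen i) = 0 ↔ i ∈ W := fun i => (hm _).symm.trans (hM i)
  have hl0 : ∀ i, l (r.gen i) = 0 ↔ i ∈ W := fun i => (hl _).symm.trans (hN i)
  have hL : degGroup 𝒜 (M.asIdeal.restrictScalars k) = r.degreeSubgroup W :=
    r.degGroup_eq M.isMaximal.isPrime.isGradedPrime hM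
  set L := r.degreeSubgroup W with hLdef
  -- The value the character sought must take at `r.deg i`. For `i ∈ W` both points vanish and
  -- impose nothing; the default 1 here, with degree 0 in `δ`, removes these indices.
  let ρ : Fin n → kˣ := fun i => if hi : i ∈ W then 1 else
    Units.mk0 (l (r.gen i)) (mt (hl0 i).1 hi) / Units.mk0 (m (r.gen i)) (mt (hm0 i).1 hi)
  have hρ : ∀ i ∉ W, l (r.gen i) = ρ i * m (r.gen i) := fun i hi => by
    simp only [ρ, dif_neg hi, Units.val_div_eq_div_val, Units.val_mk0]
    rw [div_mul_cancel₀ _ (mt (hm0 i).1 hi)]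
  let Q : AddSubgroup G := L ⊓ c.perp L
  let δ : Fin n → G := fun i => if i ∈ W then 0 else r.deg i
  let F₀ : (Fin n → ℤ) →+ G := ∑ i, (zmultiplesHom G (δ i)).comp (Pi.evalAddMonoidHom _ i)
  have hF₀ : ∀ z, F₀ z = ∑ i, z i • δ i := fun z => by simp [F₀]
  let τ : (Fin n → ℤ) →+ Additive kˣ :=
    ∑ i, (zmultiplesHom _ (Additive.ofMul (ρ i))).comp (Pi.evalAddMonoidHom _ i)
  have hτ : ∀ z, (τ z).toMul = ∏ i, ρ i ^ z i := fun z => by simp [τ]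
  have hker : ((QuotientAddGroup.mk' Q).comp F₀).ker ≤ τ.ker := by
    intro z hz
    have hzQ : F₀ z ∈ c.perp L := ((QuotientAddGroup.eq_zero_iff (N := Q) _).1 hz).2
    -- Positive and negative parts of `z`: a relation among degrees modulo the radical becomes a
    -- pair of monomials on the same coset.
    let α : Fin n → ℕ := fun i => if i ∈ W then 0 else (z i).toNat
    let β : Fin n → ℕ := fun i => if i ∈ W then 0 else (-z i).toNat
    have hdeg : r.monoDeg α - r.monoDeg β = F₀ z := by
      rw [hF₀, monoDeg, monoDeg, ← Finset.sum_sub_distrib]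
      refine Finset.sum_congr rfl fun i _ => ?_
      by_cases hi : i ∈ W
      · simp [α, β, δ, hi]
      · simp only [α, β, δ, if_neg hi]
        rw [← natCast_zsmul, ← natCast_zsmul, ← sub_smul, Int.toNat_sub_toNat_neg]
    have hlm : ∀ γ : Fin n → ℕ, (∀ i ∈ W, γ i = 0) →
        l (r.mono γ) = (∏ i, ρ i ^ γ i : kˣ) * m (r.mono γ) ∧ m (r.mono γ) ≠ 0 := by
      intro γ hγ
      constructor
      · rw [mono, map_prod, map_prod, Units.coe_prod, ← Finset.prod_mul_distrib]
        refine Finset.prod_congr rfl fun i _ => ?_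
        by_cases hi : i ∈ W
        · simp [hγ i hi]
        · rw [map_pow, map_pow, hρ i hi, mul_pow, Units.val_pow_eq_pow_val]
      · rw [mono, map_prod]
        refine Finset.prod_ne_zero_iff.2 fun i _ => ?_
        by_cases hi : i ∈ W
        · simp [hγ i hi]
        · rw [map_pow]
          exact pow_ne_zero _ (mt (hm0 i).1 hi)
    obtain ⟨hα, hα0⟩ := hlm α fun i hi => if_pos hi
    obtain ⟨hβ, hβ0⟩ := hlm β fun i hi => if_pos hi
    -- This binomial is on one coset and vanishes at `m`, so it is in the common core. Its vanishing
    -- at `l` is the relation required of the ratios `ρ`.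
    have hzc : m (r.mono β) • r.mono α - m (r.mono α) • r.mono β ∈ primeCore 𝒜 c M.asIdeal := by
      refine InCoset.mem_biCore (h := r.monoDeg β) ((InCoset.smul ?_ _).sub
        ((InCoset.of_mem (r.mono_mem β)).smul _)) ?_
      · refine (InCoset.of_mem (r.mono_mem α)).of_sub_mem ?_
        rw [hdeg, hL]
        exact hzQ
      · rw [hm, map_sub, map_smul, map_smul, smul_eq_mul, smul_eq_mul, mul_comm, sub_self]
    rw [hMN] at hzc
    have h1 := (hl _).1 (primeCore_le hzc)
    rw [map_sub, map_smul, map_smul, smul_eq_mul, smul_eq_mul, hα, hβ, sub_eq_zero, mul_left_comm,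
      mul_left_comm (m (r.mono α)), mul_comm (m (r.mono α))] at h1
    have h2 : (∏ i, ρ i ^ α i : kˣ) = ∏ i, ρ i ^ β i :=
      Units.ext (mul_right_cancel₀ (mul_ne_zero hβ0 hα0) h1)
    have h3 : (∏ i, ρ i ^ z i) = (∏ i, ρ i ^ α i) / ∏ i, ρ i ^ β i := by
      rw [← Finset.prod_div_distrib]
      refine Finset.prod_congr rfl fun i _ => ?_
      by_cases hi : i ∈ W
      · simp [ρ, hi]
      · simp only [α, β, if_neg hi]
        rw [← zpow_natCast, ← zpow_natCast, div_eq_mul_inv, ← zpow_sub, Int.toNat_sub_toNat_neg]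
    have h4 : (τ z).toMul = 1 := by rw [hτ, h3, h2, div_self']
    exact h4
  obtain ⟨T, hT⟩ := exists_hom_comp_eq _ τ hker
  let t : AddChar G kˣ :=
    { toFun := fun x => (T (QuotientAddGroup.mk' Q x)).toMul
      map_zero_eq_one' := by simp
      map_add_eq_mul' := fun x y => by simp }
  have htQ : ∀ x ∈ Q, t x = 1 := fun x hx => by
    have h1 : QuotientAddGroup.mk' Q x = 0 := (QuotientAddGroup.eq_zero_iff x).2 hx
    change (T (QuotientAddGroup.mk' Q x)).toMul = 1
    rw [h1, map_zero, toMul_zero]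
  have hti : ∀ i ∉ W, t (r.deg i) = ρ i := fun i hi => by
    have h1 := congrArg Additive.toMul (hT (Pi.single i 1))
    rw [hτ, AddMonoidHom.comp_apply, hF₀,
      Finset.sum_eq_single i (fun j _ hj => by simp [hj]) (by simp),
      Finset.prod_eq_single i (fun j _ hj => by simp [hj]) (by simp)] at h1
    have h2 : (T (QuotientAddGroup.mk' Q (r.deg i))).toMul = ρ i := by simpa [δ, hi] using h1
    exact h2
  have hlt : l = m.comp (charAut 𝒜 t : R →ₐ[k] R) := by
    refine AlgHom.ext_of_adjoin_eq_top r.adjoin_eq_top ?_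
    rintro _ ⟨i, rfl⟩
    change l (r.gen i) = m (charAut 𝒜 t (r.gen i))
    rw [charAut_of_mem 𝒜 t (r.gen_mem i), map_smul, smul_eq_mul]
    by_cases hi : i ∈ W
    · rw [(hl0 i).2 hi, (hm0 i).2 hi, mul_zero]
    · rw [hti i hi, hρ i hi]
  -- `l` is `m` composed with the action of `t`, so its kernel is `t⁻¹(M)`.
  refine ⟨t⁻¹, inv_mem (r.mem_radPerp.2 fun x hx hx' => htQ x ⟨hx, hx'⟩), MaximalSpectrum.ext ?_⟩
  ext a
  change _ ↔ (charAut 𝒜 t⁻¹).symm a ∈ M.asIdeal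
  rw [charAut_symm_apply, AddChar.inv_inv_of_units, hl, hm, hlt]
  rfl

end Twist

/-! ### The quotient map from `max R` to `prim A` and its fibres -/

section Twist

variable {k : Type u} {R : Type v} {G : Type w} [Field k] [IsAlgClosed k] [CommRing R]
  [Algebra k R] [Algebra.FiniteType k R]
  [AddCommGroup G] [DecidableEq G] {𝒜 : G → Submodule k R} [GradedAlgebra 𝒜]
  {c : AlternatingBicharacter G k}

variable (𝒜) in
/-- The map `max R → prim A`. -/
noncomputable def coreMax
    (hc : (-1 : kˣ) ∉ Subgroup.closure (Set.range fun p : G × G => c p.1 p.2) ∨ CharP k 2)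
    (M : MaximalSpectrum R) : PrimitiveIdealSpace (CocycleTwist 𝒜 c) :=
  ⟨_, isPrimitiveIdeal_primeCore hc M.isMaximal⟩

variable {hc : (-1 : kˣ) ∉ Subgroup.closure (Set.range fun p : G × G => c p.1 p.2) ∨ CharP k 2}

theorem asIdeal_coreMax (M : MaximalSpectrum R) :
    (coreMax 𝒜 hc M).asIdeal = (coreSpec 𝒜 hc M.toPrimeSpectrum).asIdeal := rfl

theorem coreMax_eq_iff {M N : MaximalSpectrum R} :
    coreMax 𝒜 hc M = coreMax 𝒜 hc N ↔ primeCore 𝒜 c M.asIdeal = primeCore 𝒜 c N.asIdeal := by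
  rw [PrimitiveIdealSpace.ext_iff, asIdeal_coreMax, asIdeal_coreMax,
    ← TwoSidedIdeal.untwist_injective.eq_iff, untwist_coreSpec, untwist_coreSpec,
    (Submodule.restrictScalars_injective k R R).eq_iff]
  rfl

theorem coreMax_surjective : Function.Surjective (coreMax 𝒜 hc) := by
  intro Q
  obtain ⟨M, hM, h⟩ := Q.isPrimitive.exists_eq_primeCore hc
  refine ⟨⟨M, hM⟩, PrimitiveIdealSpace.ext (TwoSidedIdeal.untwist_injective ?_)⟩
  rw [h, asIdeal_coreMax, untwist_coreSpec]
  rfl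

theorem coreMax_charMax (h : AddChar G kˣ) (M : MaximalSpectrum R) :
    coreMax 𝒜 hc (charMax 𝒜 h M) = (coreMax 𝒜 hc M).act (charAutTwist 𝒜 c h).toRingEquiv :=
  PrimitiveIdealSpace.ext
    (PrimeIdealSpace.ext_iff.1 (coreSpec_charSpec (hc := hc) h M.toPrimeSpectrum))

/-- The argument for `spec` restricts, because conjugates of a maximal ideal are maximal, so the
core is still an intersection of points of the same fibre. -/
theorem isQuotientMap_coreMax : Topology.IsQuotientMap (coreMax 𝒜 hc) := by
  have hnoeth : IsNoetherianRing R := Algebra.FiniteType.isNoetherianRing k R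
  rw [Topology.isQuotientMap_iff_isClosed]
  refine ⟨coreMax_surjective, fun Y => ⟨fun hY => ?_, fun hY => ?_⟩⟩
  · obtain ⟨_, h, rfl⟩ := isClosed_induced_iff.1 hY
    exact isClosed_induced_iff.2 ⟨_, h.preimage (isQuotientMap_coreSpec (hc := hc)).continuous, rfl⟩
  · obtain ⟨_, h, hZ'⟩ := isClosed_induced_iff.1 hY
    obtain ⟨Z, rfl⟩ := (PrimeSpectrum.isClosed_iff_zeroLocus _).1 h
    have hmem : ∀ M : MaximalSpectrum R, coreMax 𝒜 hc M ∈ Y ↔ Z ⊆ M.asIdeal := fun M =>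
      (Set.ext_iff.1 hZ' M).symm
    rw [PrimitiveIdealSpace.isClosed_iff]
    refine ⟨CocycleTwist.twist 𝒜 c '' Z, Set.ext fun Q => ?_⟩
    obtain ⟨M, rfl⟩ := coreMax_surjective (hc := hc) Q
    rw [Set.mem_ofPred_eq, asIdeal_coreMax, coe_coreSpec,
      Set.image_subset_image_iff (CocycleTwist.twist 𝒜 c).injective]
    refine ⟨fun hM => subset_primeCore (hc := hc) fun t ht => ?_,
      fun hM => (hmem M).2 (hM.trans primeCore_le)⟩
    have ht' : coreMax 𝒜 hc (charMax 𝒜 t M) = coreMax 𝒜 hc M :=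
      PrimitiveIdealSpace.ext (PrimeIdealSpace.ext_iff.1 ht)
    exact (hmem (charMax 𝒜 t M)).1 (ht' ▸ hM)

theorem coreMax_mem_primStratum {n : ℕ} {r : HomogeneousGenerators 𝒜 n} {W : Set (Fin n)}
    {M : MaximalSpectrum R} : coreMax 𝒜 hc M ∈ r.primStratum W c ↔ M ∈ r.maxStratum W :=
  forall_congr' fun i => iff_congr
    ((mem_coreSpec (hc := hc) (P := M.toPrimeSpectrum)).trans
      ⟨fun h => primeCore_le h, fun h => mem_biCore_of_mem (r.gen_mem i) h⟩) Iff.rfl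

/-- The fibres of `max R → prim A` are orbits. -/
theorem preimage_coreMax {n : ℕ} {r : HomogeneousGenerators 𝒜 n} {W : Set (Fin n)}
    {M : MaximalSpectrum R} (hM : M ∈ r.maxStratum W) :
    coreMax 𝒜 hc ⁻¹' {coreMax 𝒜 hc M} = maxOrbit 𝒜 (r.radPerp W c) M := by
  have hP := M.isMaximal.isPrime
  ext N
  rw [Set.mem_preimage, Set.mem_singleton_iff, coreMax_eq_iff]
  refine ⟨fun h => r.exists_charMax_eq hM h.symm, ?_⟩
  rintro ⟨t, ht, rfl⟩
  have hL := r.degGroup_eq (S := M.asIdeal.restrictScalars k) hP.isGradedPrime hM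
  -- Applied to both `t` and `t⁻¹`, stability shows that the core of `t(M)` is that of `M`.
  have hst : ∀ t ∈ r.radPerp W c, ∀ a ∈ primeCore 𝒜 c M.asIdeal,
      gradedScale 𝒜 (fun x => (t x : k)) a ∈ primeCore 𝒜 c M.asIdeal := by
    intro t ht a ha
    refine gradedScale_mem_primeCore ?_ ha
    rw [hL]
    exact r.mem_radPerp.1 ht
  ext a
  refine (mem_primeCore_comap t M.asIdeal a).trans ⟨fun h => ?_, fun h => hst _ (inv_mem ht) _ h⟩
  rw [charAut_symm_apply] at h
  rw [← gradedScale_char_inv_right 𝒜 t a]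
  exact hst t ht _ h

end Twist

theorem theorem4p5 {k : Type u} {R : Type v} {G : Type w} [Field k] [IsAlgClosed k]
    [CommRing R] [Algebra k R] [Algebra.FiniteType k R] [AddCommGroup G] [DecidableEq G]
    (𝒜 : G → Submodule k R) [GradedAlgebra 𝒜] (c : AlternatingBicharacter G k)
    (hc : (-1 : kˣ) ∉ Subgroup.closure (Set.range fun p : G × G => c p.1 p.2) ∨ CharP k 2) :
    ∃ (φs : PrimeSpectrum R → PrimeIdealSpace (CocycleTwist 𝒜 c))
      (φm : MaximalSpectrum R → PrimitiveIdealSpace (CocycleTwist 𝒜 c)),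
      Topology.IsQuotientMap φs ∧ Topology.IsQuotientMap φm ∧
      (∀ (h : AddChar G kˣ) (P : PrimeSpectrum R),
        φs (charSpec 𝒜 h P) = (φs P).act (charAutTwist 𝒜 c h).toRingEquiv) ∧
      (∀ (h : AddChar G kˣ) (M : MaximalSpectrum R),
        φm (charMax 𝒜 h M) = (φm M).act (charAutTwist 𝒜 c h).toRingEquiv) ∧
      (∀ P : PrimeSpectrum R,
        IsGreatest {I : TwoSidedIdeal (CocycleTwist 𝒜 c) |
          (I : Set (CocycleTwist 𝒜 c)) ⊆ CocycleTwist.twist 𝒜 c '' (P.asIdeal : Set R)}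
          (φs P).asIdeal) ∧
      ∀ (n : ℕ) (r : HomogeneousGenerators 𝒜 n) (W : Set (Fin n)),
        (∀ P ∈ r.specStratum W,
          ((φs P).asIdeal : Set (CocycleTwist 𝒜 c)) =
            CocycleTwist.twist 𝒜 c '' (orbitInf 𝒜 P.asIdeal (r.radPerp W c) : Set R)) ∧
        (∀ M ∈ r.maxStratum W,
          ((φm M).asIdeal : Set (CocycleTwist 𝒜 c)) =
            CocycleTwist.twist 𝒜 c '' (orbitInf 𝒜 M.asIdeal (r.radPerp W c) : Set R)) ∧
        (fun Q => φm ⁻¹' {Q}) '' r.primStratum W c =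
          maxOrbit 𝒜 (r.radPerp W c) '' r.maxStratum W := by
  have hnoeth : IsNoetherianRing R := Algebra.FiniteType.isNoetherianRing k R
  refine ⟨coreSpec 𝒜 hc, coreMax 𝒜 hc, isQuotientMap_coreSpec, isQuotientMap_coreMax,
    coreSpec_charSpec, coreMax_charMax, isGreatest_coreSpec, fun n r W => ⟨?_, ?_, ?_⟩⟩
  · intro P hP
    rw [orbitInf_eq_primeCore r P.isPrime hP, coe_coreSpec]
  · intro M hM
    rw [orbitInf_eq_primeCore r M.isMaximal.isPrime hM, asIdeal_coreMax, coe_coreSpec]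
    rfl
  · ext X
    constructor
    · rintro ⟨Q, hQ, rfl⟩
      obtain ⟨M, rfl⟩ := coreMax_surjective (hc := hc) Q
      have hM := coreMax_mem_primStratum.1 hQ
      exact ⟨M, hM, (preimage_coreMax hM).symm⟩
    · rintro ⟨M, hM, rfl⟩
      exact ⟨coreMax 𝒜 hc M, coreMax_mem_primStratum.2 hM, preimage_coreMax hM⟩
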